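/- Let $R$ be a commutative noetherian local ring with maximal ideal $\mathfrak m$, residue field $k=R/\mathfrak m$ and $\mathfrak m$-adic completion $\widehat R$. Let $E=E_R(k)$ be an injective hull of $k$, and write $(-)^\vee=\operatorname{Hom}_R(-,E)$. An $R$-module $M$ is *mini-max* if it has a noetherian submodule $N$ with $M/N$ artinian, and *Matlis reflexive* if the biduality map $M\to M^{\vee\vee}$, $x\mapsto(\psi\mapsto\psi(x))$, is an isomorphism. For $R$-modules $L,L'$, an injective resolution $J$ of $L'$ and $i\ge 0$, let $\Theta^i_{LL'}\colon \operatorname{Tor}_i^R(L,L'^\vee)\to \operatorname{Ext}^i_R(L,L')^\vee$ be the composition $$\operatorname{Tor}_i^R(L,L'^\vee)\xrightarrow{\cong} H_i(L\otimes_R J^\vee)\xrightarrow{H_i(\theta)}H_i(\operatorname{Hom}_R(L,J)^\vee)\xrightarrow{\cong}H^i(\operatorname{Hom}_R(L,J))^\vee\cong\operatorname{Ext}^i_R(L,L')^\vee,$$ where $\theta(l\otimes\psi)(\phi)=\psi(\phi(l))$ and the first map is induced by a lift of $\mathrm{id}_{L'^\vee}$ to a chain map from a projective resolution of $L'^\vee$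 to the flat resolution $J^\vee$. Let $M$ and $M'$ be mini-max $R$-modules and let $i\ge 0$. Assume that $R/(\operatorname{Ann}_R(M)+\operatorname{Ann}_R(M'))$ is ($\mathfrak m$-adically) complete, or that $M$ is Matlis reflexive, or that $M'$ is Matlis reflexive. Then $\Theta^i_{MM'}\colon\operatorname{Tor}_i^R(M,M'^\vee)\to\operatorname{Ext}^i_R(M,M')^\vee$ is an isomorphism. Moreover, each of $E$ and $\operatorname{Ext}^i_R(M,M')$ has exactly one $\widehat R$-module structure compatible with its $R$-module structure, and with respect to these structures $\operatorname{Hom}_{\widehat R}(\operatorname{Ext}^i_R(M,M'),E)=\operatorname{Ext}^i_R(M,M')^\vee$, that is, every $R$-linear map $\operatorname{Ext}^i_R(M,M')\to E$ is $\widehat R$-linear. -/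

import Mathlib

open CategoryTheory

universe u

noncomputable section

namespace Matlis

/-! ### Modules -/

section Modules

variable (R : Type u) [CommRing R]

/-- `M` has a noetherian submodule with artinian quotient. -/
def IsMinimax (M : Type u) [AddCommGroup M] [Module R M] : Prop :=
  ∃ N : Submodule R M, IsNoetherian R N ∧ IsArtinian R (M ⧸ N)

/-- The biduality map `M → Hom(Hom(M, E), E)`, `x ↦ (ψ ↦ ψ x)`. -/
def biduality (E M : Type u) [AddCommGroup E] [Module R E] [AddCommGroup M] [Module R M] :
    M →ₗ[R] ((M →ₗ[R] E) →ₗ[R] E) :=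
  (LinearMap.id : (M →ₗ[R] E) →ₗ[R] (M →ₗ[R] E)).flip

/-- `M` is reflexive with respect to `Hom(-, E)`; for `E` an injective hull of the residue field
this is Matlis reflexivity. -/
def IsMatlisReflexive (E M : Type u) [AddCommGroup E] [Module R E] [AddCommGroup M] [Module R M] :
    Prop :=
  Function.Bijective (biduality R E M)

variable {R} in
/-- `ι : K → E` exhibits `E` as an injective hull of `K`: the module `E` is injective and `ι` is
an essential monomorphism. -/
structure IsInjectiveHull {K E : Type u} [AddCommGroup K] [Module R K] [AddCommGroup E]
    [Module R E] (ι : K →ₗ[R] E) : Prop where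
  injective_module : Module.Injective R E
  injective_map : Function.Injective ι
  essential : ∀ N : Submodule R E, N ⊓ LinearMap.range ι = ⊥ → N = ⊥

/-- A module structure over the `𝔪`-adic completion of the local ring `R` on the `R`-module `L`
that is compatible with the given `R`-module structure. -/
structure CompletionStructure [IsLocalRing R] (L : Type u) [AddCommGroup L] [Module R L] where
  module : Module (AdicCompletion (IsLocalRing.maximalIdeal R) R) L
  isScalarTower : IsScalarTower R (AdicCompletion (IsLocalRing.maximalIdeal R) R) L

/-- For `R`-modules `L` and `L'` with compatible structures over the completion `R^` of `R`, the
inclusion of `Hom_{R^}(L, L')` into `Hom_R(L, L')`. -/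
def completionHomInclusion [IsLocalRing R] {L L' : Type u} [AddCommGroup L] [Module R L]
    [AddCommGroup L'] [Module R L'] (S : CompletionStructure R L) (S' : CompletionStructure R L') :
    letI := S.module
    letI := S'.module
    (L →ₗ[AdicCompletion (IsLocalRing.maximalIdeal R) R] L') → (L →ₗ[R] L') :=
  letI := S.module
  letI := S'.module
  haveI := S.isScalarTower
  haveI := S'.isScalarTower
  fun f => f.restrictScalars R

end Modules

/-! ### Complexes -/

variable {R : Type u} [CommRing R]

/-- The chain complex `Hom(C, E)` for a cochain complex `C`. -/
def dualComplex (E : Type u) [AddCommGroup E] [Module R E]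
    (C : CochainComplex (ModuleCat.{u} R) ℕ) : ChainComplex (ModuleCat.{u} R) ℕ where
  X n := ModuleCat.of R (C.X n →ₗ[R] E)
  d i j := ModuleCat.ofHom (LinearMap.lcomp R E (C.d j i).hom)
  shape i j h := by
    rw [C.shape j i h]
    ext f x
    simp
  d_comp_d' i j k _ _ := by
    ext f x
    have := C.d_comp_d k j i
    have h2 : (C.d j i).hom ((C.d k j).hom x) = 0 := by
      rw [← LinearMap.comp_apply, ← ModuleCat.hom_comp, this]; rfl
    simp [h2]

/-- The cochain complex `Hom(L, C)` for a module `L` and a cochain complex `C`. -/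
def homComplex (L : ModuleCat.{u} R) (C : CochainComplex (ModuleCat.{u} R) ℕ) :
    CochainComplex (ModuleCat.{u} R) ℕ where
  X n := ModuleCat.of R (L →ₗ[R] C.X n)
  d i j := ModuleCat.ofHom (LinearMap.compRight R (M := L) (C.d i j).hom)
  shape i j h := by
    rw [C.shape i j h]
    ext f x
    simp
  d_comp_d' i j k _ _ := by
    ext f x
    have := C.d_comp_d i j k
    have h2 : (C.d j k).hom ((C.d i j).hom (f x)) = 0 := by
      rw [← LinearMap.comp_apply, ← ModuleCat.hom_comp, this]; rfl
    simp [h2]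

/-- The Hom-evaluation map `L ⊗ Hom(J, E) → Hom(Hom(L, J), E)` of modules,
`l ⊗ ψ ↦ (φ ↦ ψ (φ l))`. -/
def homEval (L J E : Type u) [AddCommGroup L] [Module R L] [AddCommGroup J] [Module R J]
    [AddCommGroup E] [Module R E] :
    TensorProduct R L (J →ₗ[R] E) →ₗ[R] ((L →ₗ[R] J) →ₗ[R] E) :=
  TensorProduct.lift
    (LinearMap.mk₂ R (fun l ψ => ψ ∘ₗ LinearMap.applyₗ l)
      (fun l l' ψ => by ext φ; simp) (fun r l ψ => by ext φ; simp)
      (fun l ψ ψ' => by ext φ; simp) (fun r l ψ => by ext φ; simp))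

@[simp]
theorem homEval_tmul (L J E : Type u) [AddCommGroup L] [Module R L] [AddCommGroup J] [Module R J]
    [AddCommGroup E] [Module R E] (l : L) (ψ : J →ₗ[R] E) (φ : L →ₗ[R] J) :
    homEval L J E (TensorProduct.tmul R l ψ) φ = ψ (φ l) := rfl

/-- The Hom-evaluation morphism `L ⊗ Hom(C, E) → Hom(Hom(L, C), E)` of complexes. -/
def homEvalComplex (E : Type u) [AddCommGroup E] [Module R E] (L : ModuleCat.{u} R)
    (C : CochainComplex (ModuleCat.{u} R) ℕ) :
    (((MonoidalCategory.tensoringLeft (ModuleCat.{u} R)).obj L).mapHomologicalComplex _).obj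
      (dualComplex E C) ⟶ dualComplex E (homComplex L C) where
  f n := ModuleCat.ofHom (homEval L (C.X n) E)
  comm' i j _ := by
    apply ModuleCat.hom_ext
    apply TensorProduct.ext'
    intro l ψ
    rfl

theorem dualComplex_cycle (E : Type u) [AddCommGroup E] [Module R E]
    (C : CochainComplex (ModuleCat.{u} R) ℕ) (i : ℕ) (ψ : C.X i →ₗ[R] E)
    (h : ((dualComplex E C).sc i).g.hom ψ = 0) (j : ℕ) : ψ ∘ₗ (C.d j i).hom = 0 := by
  by_cases hj : (ComplexShape.up ℕ).Rel j i
  · have hk : (ComplexShape.down ℕ).next i = j := ComplexShape.next_eq' _ hj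
    subst hk
    exact h
  · rw [C.shape j i hj]
    ext x
    simp

theorem cycle_d (C : CochainComplex (ModuleCat.{u} R) ℕ) (i : ℕ) (z : C.X i)
    (h : (C.sc i).g.hom z = 0) (j : ℕ) : (C.d i j).hom z = 0 := by
  by_cases hj : (ComplexShape.up ℕ).Rel i j
  · have hk : (ComplexShape.up ℕ).next i = j := ComplexShape.next_eq' _ hj
    subst hk
    exact h
  · rw [C.shape i j hj]
    rfl

/-- For a cochain complex `C`, the natural map `H_i(Hom(C, E)) → Hom(H^i(C), E)`,
`[ψ] ↦ ([z] ↦ ψ z)`, on the concrete quotients of cycles by boundaries. -/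
def dualHomologyAux (E : Type u) [AddCommGroup E] [Module R E]
    (C : CochainComplex (ModuleCat.{u} R) ℕ) (i : ℕ) :
    ((dualComplex E C).sc i).moduleCatLeftHomologyData.H →ₗ[R]
      ((C.sc i).moduleCatLeftHomologyData.H →ₗ[R] E) :=
  Submodule.liftQ _
    { toFun := fun ψ : LinearMap.ker ((dualComplex E C).sc i).g.hom => Submodule.liftQ _
        (LinearMap.comp (M₂ := C.X i) (M₃ := E) ψ.1
          (LinearMap.ker (C.sc i).g.hom).subtype) (by
          rintro _ ⟨x, rfl⟩
          exact LinearMap.congr_fun (dualComplex_cycle E C i ψ.1 ψ.2 _) x)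
      map_add' := fun ψ ψ' => by
        apply LinearMap.ext
        intro z
        obtain ⟨z, rfl⟩ := Submodule.mkQ_surjective _ z
        rfl
      map_smul' := fun r ψ => by
        apply LinearMap.ext
        intro z
        obtain ⟨z, rfl⟩ := Submodule.mkQ_surjective _ z
        rfl } (by
    rintro _ ⟨χ, rfl⟩
    apply LinearMap.ext
    intro z
    obtain ⟨z, rfl⟩ := Submodule.mkQ_surjective _ z
    have hz := cycle_d C i z.1 z.2 ((ComplexShape.down ℕ).prev i)
    change (show C.X _ →ₗ[R] E from χ) ((C.d i _).hom z.1) = 0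
    rw [hz, map_zero])

/-- For a cochain complex `C`, the natural map `H_i(Hom(C, E)) → Hom(H^i(C), E)`,
`[ψ] ↦ ([z] ↦ ψ z)`. -/
def dualHomology (E : Type u) [AddCommGroup E] [Module R E]
    (C : CochainComplex (ModuleCat.{u} R) ℕ) (i : ℕ) :
    (dualComplex E C).homology i →ₗ[R] (C.homology i →ₗ[R] E) :=
  LinearMap.lcomp R E (C.sc i).moduleCatHomologyIso.hom.hom ∘ₗ dualHomologyAux E C i ∘ₗ
    ((dualComplex E C).sc i).moduleCatHomologyIso.hom.hom

/-! ### `Ext` through an injective resolution -/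

open InjectiveResolution in
theorem smul_extMk {L L' : ModuleCat.{u} R} (J : InjectiveResolution L') {n : ℕ}
    (f : L ⟶ J.cocomplex.X n) (m : ℕ) (hm : n + 1 = m) (hf : f ≫ J.cocomplex.d n m = 0) (r : R) :
    J.extMk (r • f) m hm (by rw [Linear.smul_comp, hf, smul_zero]) = r • J.extMk f m hm hf := by
  rw [Abelian.Ext.smul_eq_comp_mk₀]
  let φ : InjectiveResolution.Hom J J (r • 𝟙 L') :=
    { hom := r • 𝟙 J.cocomplex
      ι_f_zero_comp_hom_f_zero := by
        have h : ∀ g : L' ⟶ J.cocomplex.X 0,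
            g ≫ (r • 𝟙 (J.cocomplex.X 0)) = (r • 𝟙 L') ≫ g := by simp
        exact h (J.ι.f 0) }
  rw [extMk_comp_mk₀ f m hm hf φ]
  congr 1

theorem extMk_zero_eq_zero {L L' : ModuleCat.{u} R} (J : InjectiveResolution L')
    (f : L ⟶ J.cocomplex.X 0) (m : ℕ) (hm : 0 + 1 = m) (hf : f ≫ J.cocomplex.d 0 m = 0)
    (h : J.extMk f m hm hf = 0) : f = 0 := by
  simp only [← J.extEquivCohomologyClass.apply_eq_iff_eq,
    InjectiveResolution.extEquivCohomologyClass_extMk,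
    InjectiveResolution.extEquivCohomologyClass_zero,
    CochainComplex.HomComplex.CohomologyClass.mk_eq_zero_iff] at h
  rw [CochainComplex.HomComplex.Cocycle.fromSingleMk_mem_coboundaries_iff _ _ _ _ _ (-1)
    (by simp)] at h
  obtain ⟨g, hg⟩ := h
  have hz : g = 0 :=
    (CochainComplex.isZero_of_isStrictlyGE J.cochainComplex 0 (-1) (by lia)).eq_of_tgt _ _
  rw [hz, Limits.zero_comp] at hg
  rw [← cancel_mono (J.cochainComplexXIso (0 : ℕ) 0 rfl).inv, ← hg, Limits.zero_comp]

theorem cocycle_comp (L : ModuleCat.{u} R) (C : CochainComplex (ModuleCat.{u} R) ℕ) (i : ℕ)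
    (f : L →ₗ[R] C.X i) (hf : ((homComplex L C).sc i).g.hom f = 0) :
    ModuleCat.ofHom f ≫ C.d i (i + 1) = 0 :=
  ModuleCat.hom_ext (cycle_d (homComplex L C) i f hf (i + 1))

/-- The `R`-linear map sending a cocycle `f : L → J^i` to its class in `Ext^i(L, L')`. -/
def cocycleToExt (L : ModuleCat.{u} R) {L' : ModuleCat.{u} R} (J : InjectiveResolution L')
    (i : ℕ) :
    LinearMap.ker ((homComplex L J.cocomplex).sc i).g.hom →ₗ[R] Abelian.Ext L L' i where
  toFun f := J.extMk (ModuleCat.ofHom (X := L) (Y := J.cocomplex.X i) f.1) (i + 1) rfl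
    (cocycle_comp L J.cocomplex i f.1 f.2)
  map_add' f g := (J.add_extMk _ _ (i + 1) rfl (cocycle_comp L J.cocomplex i f.1 f.2)
    (cocycle_comp L J.cocomplex i g.1 g.2)).symm
  map_smul' r f := smul_extMk J _ (i + 1) rfl (cocycle_comp L J.cocomplex i f.1 f.2) r

theorem cocycleToExt_surjective (L : ModuleCat.{u} R) {L' : ModuleCat.{u} R}
    (J : InjectiveResolution L') (i : ℕ) : Function.Surjective (cocycleToExt L J i) := by
  intro α
  obtain ⟨f, hf, rfl⟩ := J.extMk_surjective α (i + 1) rfl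
  refine ⟨⟨f.hom, ?_⟩, rfl⟩
  have hk : (ComplexShape.up ℕ).next i = i + 1 := ComplexShape.next_eq' _ rfl
  change (J.cocomplex.d i ((ComplexShape.up ℕ).next i)).hom ∘ₗ f.hom = 0
  rw [hk]
  exact congrArg ModuleCat.Hom.hom hf

theorem ker_cocycleToExt (L : ModuleCat.{u} R) {L' : ModuleCat.{u} R}
    (J : InjectiveResolution L') (i : ℕ) :
    LinearMap.ker (cocycleToExt L J i) =
      LinearMap.range ((homComplex L J.cocomplex).sc i).moduleCatToCycles := by
  ext f
  constructor
  · intro hf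
    rcases i with _ | i
    · have h0 := extMk_zero_eq_zero J _ (0 + 1) rfl (cocycle_comp L J.cocomplex 0 f.1 f.2) hf
      refine ⟨0, ?_⟩
      rw [map_zero]
      exact (Subtype.ext (congrArg ModuleCat.Hom.hom h0)).symm
    · obtain ⟨g, hg⟩ := (J.extMk_eq_zero_iff _ (i + 1 + 1) rfl
        (cocycle_comp L J.cocomplex (i + 1) f.1 f.2) i rfl).1 hf
      have hk : (ComplexShape.up ℕ).prev (i + 1) = i := ComplexShape.prev_eq' _ rfl
      have hr : ∃ x : ((homComplex L J.cocomplex).X ((ComplexShape.up ℕ).prev (i + 1))),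
          ((homComplex L J.cocomplex).d _ (i + 1)).hom x = f.1 := by
        rw [hk]
        exact ⟨g.hom, congrArg ModuleCat.Hom.hom hg⟩
      obtain ⟨x, hx⟩ := hr
      exact ⟨x, Subtype.ext hx⟩
  · rintro ⟨x, rfl⟩
    rcases i with _ | i
    · have hs : ((homComplex L J.cocomplex).sc 0).f = 0 :=
        (homComplex L J.cocomplex).shape _ _ (by simp)
      have h0 : ((homComplex L J.cocomplex).sc 0).moduleCatToCycles x = 0 :=
        Subtype.ext (by
          change ((homComplex L J.cocomplex).sc 0).f.hom x = 0
          rw [hs]; rfl)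
      rw [h0]
      exact zero_mem _
    · have hk : (ComplexShape.up ℕ).prev (i + 1) = i := ComplexShape.prev_eq' _ rfl
      have hr : ∀ (k : ℕ) (_ : k = i) (x : L →ₗ[R] J.cocomplex.X k),
          ∃ g : L ⟶ J.cocomplex.X i, g ≫ J.cocomplex.d i (i + 1) =
            ModuleCat.ofHom ((J.cocomplex.d k (i + 1)).hom ∘ₗ x) := by
        rintro k rfl x
        exact ⟨ModuleCat.ofHom x, rfl⟩
      exact (J.extMk_eq_zero_iff _ (i + 1 + 1) rfl
        (cocycle_comp L J.cocomplex (i + 1) _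
          (((homComplex L J.cocomplex).sc (i + 1)).moduleCatToCycles x).2) i rfl).2 (hr _ hk x)

/-- The canonical isomorphism `H^i(Hom(L, J)) ≅ Ext^i(L, L')` for an injective resolution `J`
of `L'`. -/
def cohomologyEquivExt (L : ModuleCat.{u} R) {L' : ModuleCat.{u} R} (J : InjectiveResolution L')
    (i : ℕ) : (homComplex L J.cocomplex).homology i ≃ₗ[R] Abelian.Ext L L' i :=
  ((homComplex L J.cocomplex).sc i).moduleCatHomologyIso.toLinearEquiv ≪≫ₗ
    Submodule.quotEquivOfEq _ _ (ker_cocycleToExt L J i).symm ≪≫ₗ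
    (cocycleToExt L J i).quotKerEquivOfSurjective (cocycleToExt_surjective L J i)

/-! ### `Tor` through the dual of an injective resolution -/

theorem exists_comp_eq_of_exact {E : Type u} [AddCommGroup E] [Module R E]
    (hE : Module.Injective R E) {X Y Z : Type u} [AddCommGroup X] [Module R X] [AddCommGroup Y]
    [Module R Y] [AddCommGroup Z] [Module R Z] (f : X →ₗ[R] Y) (g : Y →ₗ[R] Z)
    (h : LinearMap.ker g ≤ LinearMap.range f) (ψ : Y →ₗ[R] E) (hψ : ψ ∘ₗ f = 0) :
    ∃ χ : Z →ₗ[R] E, χ ∘ₗ g = ψ := by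
  have hk : LinearMap.ker g ≤ LinearMap.ker ψ := fun y hy => by
    obtain ⟨x, rfl⟩ := h hy
    exact LinearMap.congr_fun hψ x
  obtain ⟨χ, hχ⟩ := Module.Injective.extension_property R E _ _
    ((LinearMap.ker g).liftQ g le_rfl)
    (LinearMap.ker_eq_bot.1 (Submodule.ker_liftQ_eq_bot _ _ _ le_rfl))
    ((LinearMap.ker g).liftQ ψ hk)
  refine ⟨χ, LinearMap.ext fun y => ?_⟩
  exact LinearMap.congr_fun hχ (Submodule.Quotient.mk y)

/-- The coaugmentation `L' → J^0` of an injective resolution. -/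
def coaug {L' : ModuleCat.{u} R} (J : InjectiveResolution L') : L' ⟶ J.cocomplex.X 0 := J.ι.f 0

/-- The augmentation `P_0 → X` of a projective resolution. -/
def aug {X : ModuleCat.{u} R} (P : ProjectiveResolution X) : P.complex.X 0 ⟶ X := P.π.f 0

/-- The Matlis dual `Hom(L', E)` as an object of the category of modules. -/
abbrev dualObj (E : Type u) [AddCommGroup E] [Module R E] (L' : ModuleCat.{u} R) :
    ModuleCat.{u} R := ModuleCat.of R (L' →ₗ[R] E)

/-- The augmentation `Hom(J^0, E) → Hom(L', E)` of the complex `Hom(J, E)`. -/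
def dualAug (E : Type u) [AddCommGroup E] [Module R E] {L' : ModuleCat.{u} R}
    (J : InjectiveResolution L') : (dualComplex E J.cocomplex).X 0 ⟶ dualObj E L' :=
  ModuleCat.ofHom (LinearMap.lcomp R E (coaug J).hom)

/-- The identity of `Hom(L', E)` lifts to a chain map from a projective resolution of
`Hom(L', E)` to `Hom(J, E)`. -/
theorem exists_lift {E : Type u} [AddCommGroup E] [Module R E] (hE : Module.Injective R E)
    {L' : ModuleCat.{u} R} (J : InjectiveResolution L')
    (P : ProjectiveResolution (dualObj E L')) :
    ∃ φ : P.complex ⟶ dualComplex E J.cocomplex, φ.f 0 ≫ dualAug E J = aug P := by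
  have hex : ∀ n, LinearMap.ker (J.cocomplex.d (n + 1) (n + 2)).hom ≤
      LinearMap.range (J.cocomplex.d n (n + 1)).hom := fun n =>
    (ShortComplex.moduleCat_exact_iff_ker_sub_range _).1 (J.exact_succ n)
  have hex0 : LinearMap.ker (J.cocomplex.d 0 1).hom ≤ LinearMap.range (coaug J).hom :=
    (ShortComplex.moduleCat_exact_iff_ker_sub_range _).1 J.exact₀
  have hinj : Function.Injective (coaug J).hom :=
    (ModuleCat.mono_iff_injective _).1 (inferInstanceAs (Mono (J.ι.f 0)))
  have hs0 : Function.Surjective (dualAug E J).hom := by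
    intro ψ
    obtain ⟨χ, hχ⟩ := Module.Injective.extension_property R E _ _ (coaug J).hom hinj ψ
    exact ⟨χ, hχ⟩
  have : Epi (dualAug E J) := (ModuleCat.epi_iff_surjective _).2 hs0
  have hw0 : (dualComplex E J.cocomplex).d 1 0 ≫ dualAug E J = 0 := by
    ext ψ x
    have h : (J.cocomplex.d 0 1).hom ((coaug J).hom x) = 0 :=
      LinearMap.congr_fun (congrArg ModuleCat.Hom.hom J.ι_f_zero_comp_complex_d) x
    change (show J.cocomplex.X 1 →ₗ[R] E from ψ) ((J.cocomplex.d 0 1).hom ((coaug J).hom x)) = 0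
    rw [h, map_zero]
  have hd0 : (ShortComplex.mk _ _ hw0).Exact := by
    rw [ShortComplex.moduleCat_exact_iff]
    intro ψ hψ
    exact exists_comp_eq_of_exact hE (coaug J).hom (J.cocomplex.d 0 1).hom hex0 ψ hψ
  have hd : ∀ n, (ShortComplex.mk _ _
      ((dualComplex E J.cocomplex).d_comp_d (n + 2) (n + 1) n)).Exact := by
    intro n
    rw [ShortComplex.moduleCat_exact_iff]
    intro ψ hψ
    exact exists_comp_eq_of_exact hE (J.cocomplex.d n (n + 1)).hom
      (J.cocomplex.d (n + 1) (n + 2)).hom (hex n) ψ hψ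
  have haug : P.complex.d 1 0 ≫ aug P = 0 := P.complex_d_comp_π_f_zero
  let zero : P.complex.X 0 ⟶ (dualComplex E J.cocomplex).X 0 :=
    Projective.factorThru (aug P) (dualAug E J)
  have hzero : zero ≫ dualAug E J = aug P := Projective.factorThru_comp _ _
  have hone : (P.complex.d 1 0 ≫ zero) ≫ dualAug E J = 0 := by
    rw [Category.assoc, hzero, haug]
  exact ⟨ChainComplex.mkHom _ _ zero (hd0.liftFromProjective (P.complex.d 1 0 ≫ zero) hone)
    (hd0.liftFromProjective_comp _ hone) fun n p =>
      have hp : (P.complex.d (n + 2) (n + 1) ≫ p.2.1) ≫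
          (dualComplex E J.cocomplex).d (n + 1) n = 0 := by
        rw [Category.assoc, p.2.2, ← Category.assoc, P.complex.d_comp_d, Limits.zero_comp]
      ⟨(hd n).liftFromProjective _ hp, (hd n).liftFromProjective_comp _ hp⟩, hzero⟩

/-- A chosen chain map from a projective resolution of `Hom(L', E)` to `Hom(J, E)` that lifts the
identity of `Hom(L', E)`; it is unique up to homotopy. -/
def liftDual {E : Type u} [AddCommGroup E] [Module R E] (hE : Module.Injective R E)
    {L' : ModuleCat.{u} R} (J : InjectiveResolution L')
    (P : ProjectiveResolution (dualObj E L')) : P.complex ⟶ dualComplex E J.cocomplex :=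
  (exists_lift hE J P).choose

theorem liftDual_comp {E : Type u} [AddCommGroup E] [Module R E] (hE : Module.Injective R E)
    {L' : ModuleCat.{u} R} (J : InjectiveResolution L')
    (P : ProjectiveResolution (dualObj E L')) : (liftDual hE J P).f 0 ≫ dualAug E J = aug P :=
  (exists_lift hE J P).choose_spec

/-- The canonical map `Tor_i(L, Hom(L', E)) → H_i(L ⊗ Hom(J, E))`, for an injective resolution
`J` of `L'`. -/
def torToHomology {E : Type u} [AddCommGroup E] [Module R E] (hE : Module.Injective R E)
    (L : ModuleCat.{u} R) {L' : ModuleCat.{u} R} (J : InjectiveResolution L') (i : ℕ) :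
    ((Tor (ModuleCat.{u} R) i).obj L).obj (dualObj E L') ⟶
      ((((MonoidalCategory.tensoringLeft (ModuleCat.{u} R)).obj L).mapHomologicalComplex _).obj
        (dualComplex E J.cocomplex)).homology i :=
  ((projectiveResolution (dualObj E L')).isoLeftDerivedObj
      ((MonoidalCategory.tensoringLeft (ModuleCat.{u} R)).obj L) i).hom ≫
    HomologicalComplex.homologyMap
      ((((MonoidalCategory.tensoringLeft (ModuleCat.{u} R)).obj L).mapHomologicalComplex _).map
        (liftDual hE J (projectiveResolution (dualObj E L')))) i

/-- The natural map `Θ^i : Tor_i(L, Hom(L', E)) → Hom(Ext^i(L, L'), E)`, computed with an injective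
resolution `J` of `L'`: the composite
`Tor_i(L, Hom(L', E)) → H_i(L ⊗ Hom(J, E)) → H_i(Hom(Hom(L, J), E)) → Hom(H^i(Hom(L, J)), E)
→ Hom(Ext^i(L, L'), E)`. -/
def Theta {E : Type u} [AddCommGroup E] [Module R E] (hE : Module.Injective R E)
    (L : ModuleCat.{u} R) {L' : ModuleCat.{u} R} (J : InjectiveResolution L') (i : ℕ) :
    ((Tor (ModuleCat.{u} R) i).obj L).obj (dualObj E L') →ₗ[R] (Abelian.Ext L L' i →ₗ[R] E) :=
  LinearMap.lcomp R E (cohomologyEquivExt L J i).symm.toLinearMap ∘ₗ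
    dualHomology E (homComplex L J.cocomplex) i ∘ₗ
    (HomologicalComplex.homologyMap (homEvalComplex E L J.cocomplex) i).hom ∘ₗ
    (torToHomology hE L J i).hom

end Matlis

end

namespace Matlis

noncomputable section

/-! ### Adic completions -/

section Completion

variable {R : Type u} [CommRing R] (a : Ideal R)

/-! `Theta` is a composite of four maps, three of which are isomorphisms for all modules. Since E is
injective, J^∨ is a resolution of M'^∨; over a noetherian ring the dual of an injective module is
flat (`flat_dual`), and flat resolutions compute Tor (`isIso_torToHomology`). Exactness of (-)^∨
gives `dualHomology_bijective`, and the identification with Ext is `cohomologyEquivExt`. Everything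
thus rests on Hom-evaluation M ⊗ J^∨ → Hom(M, J)^∨ inducing isomorphisms in homology.

This evaluation is injective in each degree (`homEval_injective`), so its cokernel complex has to be
acyclic; `IsEvalExactAt` expresses this by elements. For a finitely generated module N evaluation is
bijective, so the cokernel for M may be replaced by the one for M/N (`IsEvalExactAt.of_quotient`),
where N is noetherian and A = M/N artinian.

Let R^ be the completion. Then A and E are R^-modules and End(E) consists of multiplications by R^.
If every term of J has a finite-dimensional socle, a functional on Hom(A, J^i) agrees with an
evaluation on a given set of maps as soon as it is R^-linear along these maps
(`IsInjectiveHull.exists_sum_eq`). A cycle y of the cokernel is R^-linear on coboundaries. The ideal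
I = Ann M + Ann M' kills Ext(A, M'), so it multiplies cocycles into coboundaries; if moreover R^ = R
+ I R^, then y is R^-linear on all cocycles. There it equals an evaluation, and the difference
factors through the differential (`IsEvalExactAt.of_isArtinian`).

The equality R^ = R + I R^ (`IsSurjectiveModulo`) is what the three alternative hypotheses have in
common (`isSurjectiveModulo_annihilator_sup`). Resolutions with finite socles exist because mini-max
modules have finite Bass numbers (`IsMinimax.isExtFinite`), and a homotopy equivalence carries the
result to any J.

The same equality gives R/I = R^/I R^, whence the unique R^-structure on Ext and the R^-linearity of
all maps Ext → E. On E uniqueness comes from torsion. -/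

theorem evalₐ_eq_mk_of_le {a : Ideal R} {s : AdicCompletion a R} {m n : ℕ} {r : R} (hmn : m ≤ n)
    (h : AdicCompletion.evalₐ a n s = Ideal.Quotient.mk _ r) :
    AdicCompletion.evalₐ a m s = Ideal.Quotient.mk _ r := by
  induction s using AdicCompletion.induction_on with
  | _ b =>
    rw [AdicCompletion.evalₐ_mk, Ideal.Quotient.mk_eq_mk_iff_sub_mem] at h ⊢
    have h1 := b.2 hmn
    rw [SModEq.sub_mem, smul_eq_mul, Ideal.mul_top] at h1
    have h2 := Ideal.pow_le_pow_right hmn h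
    have := add_mem h1 h2
    simpa using this

theorem exists_evalₐ_eq_mk {a : Ideal R} (s : AdicCompletion a R) (n : ℕ) :
    ∃ r : R, AdicCompletion.evalₐ a n s = Ideal.Quotient.mk _ r := by
  obtain ⟨r, hr⟩ := Ideal.Quotient.mk_surjective (AdicCompletion.evalₐ a n s)
  exact ⟨r, hr.symm⟩

/-- An ideal of a noetherian ring generates a closed ideal of an adic completion. -/
theorem mem_map_of_forall_evalₐ_mem [IsNoetherianRing R] (I : Ideal R) (s : AdicCompletion a R)
    (h : ∀ n, AdicCompletion.evalₐ a n s ∈ I.map (Ideal.Quotient.mk (a ^ n))) :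
    s ∈ I.map (algebraMap R (AdicCompletion a R)) := by
  -- Completion is exact on I → R → R/I. The element s dies in the completion of R/I, hence comes
  -- from the completion of I, which is generated over R^ by I.
  have hex := AdicCompletion.map_exact (I := a) (f := I.subtype) (g := I.mkQ)
    I.injective_subtype (LinearMap.exact_subtype_mkQ I) I.mkQ_surjective
  have h0 : AdicCompletion.map a I.mkQ s = 0 := by
    induction s using AdicCompletion.induction_on with
    | _ b =>
      rw [AdicCompletion.map_mk]
      apply AdicCompletion.mk_zero_of
      refine ⟨0, fun n _ => ⟨n, le_rfl, n, le_rfl, ?_⟩⟩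
      have hn := h n
      rw [AdicCompletion.evalₐ_mk, Ideal.mem_map_iff_of_surjective _ Ideal.Quotient.mk_surjective]
        at hn
      obtain ⟨x, hx, hxb⟩ := hn
      rw [Ideal.Quotient.mk_eq_mk_iff_sub_mem] at hxb
      have h2 : I.mkQ (b n) = (b n - x) • I.mkQ 1 := by
        rw [← map_smul, smul_eq_mul, mul_one, map_sub]
        simp [Ideal.Quotient.eq_zero_iff_mem.2 hx]
      change I.mkQ (b n) ∈ _
      rw [h2]
      refine Submodule.smul_mem_smul ?_ trivial
      rw [← neg_sub]
      exact neg_mem hxb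
  obtain ⟨y, rfl⟩ := (hex s).1 h0
  obtain ⟨t, rfl⟩ := AdicCompletion.ofTensorProduct_surjective_of_finite a I y
  clear h0 h
  induction t using TensorProduct.induction_on with
  | zero => simp
  | add x y hx hy => rw [map_add, map_add]; exact add_mem hx hy
  | tmul r x =>
    rw [AdicCompletion.ofTensorProduct_tmul, map_smul, AdicCompletion.map_of]
    exact Ideal.mul_mem_left _ _ (Ideal.mem_map_of_mem (algebraMap R _) x.2)

theorem evalₐ_algebraMap {a : Ideal R} (r : R) (n : ℕ) :
    AdicCompletion.evalₐ a n (algebraMap R _ r) = Ideal.Quotient.mk _ r :=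
  AdicCompletion.evalₐ_of a n r

/-- The ideal generated by a^n is closed, so it suffices to look at each finite level: the
difference vanishes at levels m ≤ n, and at later levels any representative of it lies in a^n. -/
theorem sub_mem_map_pow [IsNoetherianRing R] {s : AdicCompletion a R} {n : ℕ} {r : R}
    (h : AdicCompletion.evalₐ a n s = Ideal.Quotient.mk _ r) :
    s - algebraMap R _ r ∈ (a ^ n).map (algebraMap R (AdicCompletion a R)) := by
  apply mem_map_of_forall_evalₐ_mem
  intro m
  rcases le_total m n with hmn | hmn
  · rw [map_sub, evalₐ_algebraMap, evalₐ_eq_mk_of_le hmn h, sub_self]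
    exact zero_mem _
  · obtain ⟨r', hr'⟩ := exists_evalₐ_eq_mk s m
    have hneg := evalₐ_eq_mk_of_le hmn hr'
    rw [h, Ideal.Quotient.mk_eq_mk_iff_sub_mem] at hneg
    rw [map_sub, evalₐ_algebraMap, hr', ← map_sub]
    refine Ideal.mem_map_of_mem _ ?_
    rw [← neg_sub]
    exact neg_mem hneg

/-- Every element of the `a`-adic completion is the sum of an element of `R` and an element of the
ideal generated by `I`. -/
def IsSurjectiveModulo (I : Ideal R) : Prop :=
  ∀ s : AdicCompletion a R, ∃ r : R,
    s - algebraMap R _ r ∈ I.map (algebraMap R (AdicCompletion a R))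

variable {a}

theorem IsSurjectiveModulo.mono {I I' : Ideal R} (hI : IsSurjectiveModulo a I) (h : I ≤ I') :
    IsSurjectiveModulo a I' := fun s =>
  (hI s).imp fun _ hr => Ideal.map_mono h hr

/-- Substituting R^ = R + I'R^ into IR^ gives IR^ ⊆ I + II'R^, so R^ = R + IR^ = R + II'R^. -/
theorem IsSurjectiveModulo.mul {I I' : Ideal R} (hI : IsSurjectiveModulo a I)
    (hI' : IsSurjectiveModulo a I') : IsSurjectiveModulo a (I * I') := by
  have key : ∀ t ∈ I.map (algebraMap R (AdicCompletion a R)), ∃ r : R,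
      t - algebraMap R _ r ∈ (I * I').map (algebraMap R (AdicCompletion a R)) := by
    intro t ht
    induction ht using Submodule.span_induction with
    | mem x hx =>
      obtain ⟨x, hx, rfl⟩ := hx
      exact ⟨x, by simp⟩
    | zero => exact ⟨0, by simp⟩
    | add x y _ _ hx hy =>
      obtain ⟨r, hr⟩ := hx
      obtain ⟨r', hr'⟩ := hy
      refine ⟨r + r', ?_⟩
      rw [map_add, add_sub_add_comm]
      exact add_mem hr hr'
    | smul s x hx h =>
      obtain ⟨r, hr⟩ := hI' s
      obtain ⟨y, hy⟩ := h
      refine ⟨r * y, ?_⟩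
      have h1 : (s - algebraMap R _ r) * x ∈
          (I * I').map (algebraMap R (AdicCompletion a R)) := by
        rw [Ideal.map_mul, mul_comm (Ideal.map _ I)]
        exact Ideal.mul_mem_mul hr hx
      have h2 := Ideal.mul_mem_left _ (algebraMap R (AdicCompletion a R) r) hy
      have := add_mem h1 h2
      rw [map_mul, smul_eq_mul]
      convert this using 1
      ring
  intro s
  obtain ⟨r, hr⟩ := hI s
  obtain ⟨r', hr'⟩ := key _ hr
  exact ⟨r + r', by rwa [map_add, ← sub_sub]⟩

/-- A Cauchy sequence representing s converges in R/I; let r lift the limit. At every finite level s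
- r lies in the image of I, and IR^ is closed. -/
theorem IsSurjectiveModulo.of_isAdicComplete [IsNoetherianRing R] {I : Ideal R}
    (h : IsAdicComplete a (R ⧸ I)) : IsSurjectiveModulo a I := by
  intro s
  induction s using AdicCompletion.induction_on with
  | _ b =>
    obtain ⟨L, hL⟩ := h.toIsPrecomplete.prec (f := fun n => I.mkQ (b n)) (by
      intro m n hmn
      have h1 := b.2 hmn
      rw [SModEq.sub_mem] at h1 ⊢
      have h2 := Submodule.mem_map_of_mem (f := I.mkQ) h1
      rw [Submodule.map_smul'', Submodule.map_top, Submodule.range_mkQ, map_sub] at h2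
      exact h2)
    obtain ⟨r, rfl⟩ := I.mkQ_surjective L
    refine ⟨r, mem_map_of_forall_evalₐ_mem _ _ _ fun n => ?_⟩
    have h1 := hL n
    rw [SModEq.sub_mem, ← Submodule.range_mkQ, ← Submodule.map_top, ← Submodule.map_smul'',
      ← map_sub] at h1
    obtain ⟨x, hx, hxb⟩ := h1
    rw [smul_eq_mul, Ideal.mul_top] at hx
    rw [← sub_eq_zero, ← map_sub, Submodule.mkQ_apply, Submodule.Quotient.mk_eq_zero] at hxb
    rw [map_sub, evalₐ_algebraMap, AdicCompletion.evalₐ_mk, ← map_sub]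
    have h3 : Ideal.Quotient.mk (a ^ n) (b.1 n - r) =
        Ideal.Quotient.mk (a ^ n) (-(x - (b.1 n - r))) := by
      rw [Ideal.Quotient.mk_eq_mk_iff_sub_mem]
      simpa using hx
    rw [h3]
    exact Ideal.mem_map_of_mem _ (neg_mem hxb)

end Completion

/-! ### The action of the completion on torsion modules -/

section Action

variable {R : Type u} [CommRing R]

/-- Every element of `V` is annihilated by some power of the ideal `a`. -/
def IsPowTorsion (a : Ideal R) (V : Type*) [AddCommGroup V] [Module R V] : Prop :=
  ∀ v : V, ∃ n : ℕ, ∀ x ∈ a ^ n, x • v = 0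

variable {a : Ideal R} {V W : Type*} [AddCommGroup V] [Module R V] [AddCommGroup W] [Module R W]

/-- Makes the action of the completion on torsion elements independent of the chosen annihilating
power. -/
theorem smul_eq_smul_of_evalₐ_eq {s : AdicCompletion a R} {v : V} {m n : ℕ} {r r' : R}
    (hm : ∀ x ∈ a ^ m, x • v = 0) (hn : ∀ x ∈ a ^ n, x • v = 0)
    (h : AdicCompletion.evalₐ a m s = Ideal.Quotient.mk _ r)
    (h' : AdicCompletion.evalₐ a n s = Ideal.Quotient.mk _ r') : r • v = r' • v := by
  wlog hmn : m ≤ n generalizing m n r r'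
  · exact (this hn hm h' h (le_of_not_ge hmn)).symm
  have h2 := evalₐ_eq_mk_of_le hmn h'
  rw [h, Ideal.Quotient.mk_eq_mk_iff_sub_mem] at h2
  rw [← sub_eq_zero, ← sub_smul, hm _ h2]

/-- The product of an element of the completion and an element of a torsion module. -/
def torsionSMul (hV : IsPowTorsion a V) (s : AdicCompletion a R) (v : V) : V :=
  (exists_evalₐ_eq_mk s (hV v).choose).choose • v

theorem torsionSMul_eq (hV : IsPowTorsion a V) {s : AdicCompletion a R} {v : V} {n : ℕ} {r : R}
    (hn : ∀ x ∈ a ^ n, x • v = 0) (h : AdicCompletion.evalₐ a n s = Ideal.Quotient.mk _ r) :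
    torsionSMul hV s v = r • v :=
  smul_eq_smul_of_evalₐ_eq (hV v).choose_spec hn
    (exists_evalₐ_eq_mk s (hV v).choose).choose_spec h

theorem exists_torsionSMul_eq (hV : IsPowTorsion a V) (v : V) (ss : AdicCompletion a R) :
    ∃ n, (∀ x ∈ a ^ n, x • v = 0) ∧ ∃ r, AdicCompletion.evalₐ a n ss = Ideal.Quotient.mk _ r ∧
      torsionSMul hV ss v = r • v := by
  obtain ⟨n, hn⟩ := hV v
  obtain ⟨r, hr⟩ := exists_evalₐ_eq_mk ss n
  exact ⟨n, hn, r, hr, torsionSMul_eq hV hn hr⟩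

/-- A torsion module is a module over the completion. -/
@[reducible]
def torsionModule (hV : IsPowTorsion a V) : Module (AdicCompletion a R) V where
  smul := torsionSMul hV
  one_smul v := by
    obtain ⟨n, hn⟩ := hV v
    exact (torsionSMul_eq hV hn (map_one _)).trans (one_smul R v)
  mul_smul s t v := by
    obtain ⟨n, hn⟩ := hV v
    obtain ⟨r, hr⟩ := exists_evalₐ_eq_mk s n
    obtain ⟨r', hr'⟩ := exists_evalₐ_eq_mk t n
    have h1 : torsionSMul hV t v = r' • v := torsionSMul_eq hV hn hr'
    have h2 : torsionSMul hV s (r' • v) = r • r' • v := torsionSMul_eq hV (n := n) (fun x hx => by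
      rw [smul_comm, hn x hx, smul_zero]) hr
    have h3 : torsionSMul hV (s * t) v = (r * r') • v := torsionSMul_eq hV (n := n) hn (by
      rw [map_mul, hr, hr', map_mul])
    change torsionSMul hV (s * t) v = torsionSMul hV s (torsionSMul hV t v)
    rw [h1, h2, h3, mul_smul]
  smul_zero s := by
    obtain ⟨n, -, r, -, h⟩ := exists_torsionSMul_eq hV 0 s
    exact h.trans (smul_zero r)
  smul_add s v w := by
    obtain ⟨m, hm⟩ := hV v
    obtain ⟨n, hn⟩ := hV w
    have hm' : ∀ x ∈ a ^ max m n, x • v = 0 := fun x hx =>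
      hm x (Ideal.pow_le_pow_right (le_max_left _ _) hx)
    have hn' : ∀ x ∈ a ^ max m n, x • w = 0 := fun x hx =>
      hn x (Ideal.pow_le_pow_right (le_max_right _ _) hx)
    obtain ⟨r, hr⟩ := exists_evalₐ_eq_mk s (max m n)
    change torsionSMul hV s (v + w) = torsionSMul hV s v + torsionSMul hV s w
    rw [torsionSMul_eq hV hm' hr, torsionSMul_eq hV hn' hr, ← smul_add]
    exact torsionSMul_eq hV (fun x hx => by rw [smul_add, hm' x hx, hn' x hx, add_zero]) hr
  add_smul s t v := by
    obtain ⟨n, hn⟩ := hV v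
    obtain ⟨r, hr⟩ := exists_evalₐ_eq_mk s n
    obtain ⟨r', hr'⟩ := exists_evalₐ_eq_mk t n
    change torsionSMul hV (s + t) v = torsionSMul hV s v + torsionSMul hV t v
    rw [torsionSMul_eq hV hn hr, torsionSMul_eq hV hn hr', ← add_smul]
    exact torsionSMul_eq hV hn (by rw [map_add, hr, hr', map_add])
  zero_smul v := by
    obtain ⟨n, hn⟩ := hV v
    exact (torsionSMul_eq hV hn (by simp)).trans (zero_smul R v)

theorem torsionSMul_algebraMap (hV : IsPowTorsion a V) (r : R) (v : V) :
    torsionSMul hV (algebraMap R _ r) v = r • v := by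
  obtain ⟨n, hn⟩ := hV v
  exact torsionSMul_eq hV hn (evalₐ_algebraMap r n)

theorem torsionModule_isScalarTower (hV : IsPowTorsion a V) :
    letI := torsionModule hV
    IsScalarTower R (AdicCompletion a R) V := by
  let := torsionModule hV
  refine IsScalarTower.of_algebraMap_smul fun r v => ?_
  exact torsionSMul_algebraMap hV r v

/-- Linear maps of torsion modules are linear over the completion. -/
theorem map_torsionSMul (hV : IsPowTorsion a V) (hW : IsPowTorsion a W) (f : V →ₗ[R] W)
    (s : AdicCompletion a R) (v : V) : f (torsionSMul hV s v) = torsionSMul hW s (f v) := by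
  obtain ⟨n, hn, r, hr, h⟩ := exists_torsionSMul_eq hV v s
  rw [h, map_smul]
  exact (torsionSMul_eq hW (fun x hx => by rw [← map_smul, hn x hx, map_zero]) hr).symm

/-- The product with an element of the completion as an `R`-linear map. -/
def torsionEnd (hV : IsPowTorsion a V) (s : AdicCompletion a R) : V →ₗ[R] V where
  toFun := torsionSMul hV s
  map_add' := (torsionModule hV).smul_add s
  map_smul' r v := (map_torsionSMul hV hV (LinearMap.lsmul R V r) s v).symm

@[simp]
theorem torsionEnd_apply (hV : IsPowTorsion a V) (s : AdicCompletion a R) (v : V) :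
    torsionEnd hV s v = torsionSMul hV s v := rfl

end Action

/-! ### Artinian modules -/

section Artinian

variable {R : Type u} [CommRing R]

/-- A submodule N is controlled by the layers x^n N ∩ M[x], where M[x] is the kernel of x. For a
descending chain N_i the layers decrease in both i and n inside the artinian module M[x], so they
become constant in i uniformly in n. Two nested submodules with equal layers coincide because x is
locally nilpotent. -/
theorem isArtinian_of_torsionBy {M : Type*} [AddCommGroup M] [Module R M] (x : R)
    (hx : ∀ m : M, ∃ n : ℕ, x ^ n • m = 0) (h : IsArtinian R (Submodule.torsionBy R M x)) :
    IsArtinian R M := by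
  rw [← monotone_stabilizes_iff_artinian]
  intro N
  let N' : ℕ → Submodule R M := fun i => OrderDual.ofDual (N i)
  have hN' : ∀ {i j}, i ≤ j → N' j ≤ N' i := fun hij => N.monotone hij
  let L : ℕ → ℕ → Submodule R M := fun i n =>
    (N' i).map (LinearMap.lsmul R M (x ^ n)) ⊓ Submodule.torsionBy R M x
  have hLi : ∀ {i j} (n), i ≤ j → L j n ≤ L i n := fun n hij =>
    inf_le_inf_right _ (Submodule.map_mono (hN' hij))
  have hLs : ∀ i n, L i (n + 1) ≤ L i n := by
    rintro i n y ⟨⟨z, hz, rfl⟩, hy⟩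
    refine ⟨⟨x • z, (N' i).smul_mem x hz, ?_⟩, hy⟩
    simp [pow_succ, mul_smul, smul_comm x]
  have hLn : ∀ i, Antitone (L i) := fun i => antitone_nat_of_succ_le (hLs i)
  have stab : ∀ f : ℕ → Submodule R M, Antitone f → (∀ i, f i ≤ Submodule.torsionBy R M x) →
      ∃ n, ∀ m, n ≤ m → f n = f m := by
    intro f hf hle
    obtain ⟨n, hn⟩ := (monotone_stabilizes_iff_artinian (R := R)).2 h
      ⟨fun i => OrderDual.toDual ((f i).comap (Submodule.torsionBy R M x).subtype),
        fun i j hij => Submodule.comap_mono (hf hij)⟩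
    refine ⟨n, fun m hm => ?_⟩
    have h1 : (f n).comap (Submodule.torsionBy R M x).subtype =
      (f m).comap (Submodule.torsionBy R M x).subtype := hn m hm
    have h2 := congrArg (Submodule.map (Submodule.torsionBy R M x).subtype) h1
    rwa [Submodule.map_comap_subtype, Submodule.map_comap_subtype, inf_eq_right.2 (hle n),
      inf_eq_right.2 (hle m)] at h2
  -- Stability of the diagonal from k on controls all rows n ≥ k at once; the finitely many rows n <
  -- k are stabilized separately by `c`.
  obtain ⟨k, hk⟩ := stab (fun i => L i i) (fun i j hij => (hLi j hij).trans (hLn i hij))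
    fun i => inf_le_right
  choose c hc using fun n => stab (fun i => L i n) (fun i j hij => hLi n hij)
    fun i => inf_le_right
  have hall : ∃ i₁, ∀ i, i₁ ≤ i → ∀ n, L i₁ n = L i n := by
    refine ⟨max k ((Finset.range k).sup c), fun i hi n => ?_⟩
    obtain ⟨hki, hci⟩ := max_le_iff.1 hi
    rcases lt_or_ge n k with hn | hn
    · have hcn : c n ≤ (Finset.range k).sup c := Finset.le_sup (Finset.mem_range.2 hn)
      rw [← hc n i (hcn.trans hci), ← hc n _ (hcn.trans (le_max_right _ _))]
    · have : ∀ j, k ≤ j → L j n = L k k := by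
        intro j hj
        refine le_antisymm ((hLi n hj).trans (hLn k hn)) ?_
        have := hk (max j n) (hj.trans (le_max_left _ _))
        change L k k = L _ _ at this
        rw [this]
        exact (hLi _ (le_max_left _ _)).trans (hLn _ (le_max_right _ _))
      rw [this _ (le_max_left _ _), this _ hki]
  obtain ⟨i₁, hi₁⟩ := hall
  refine ⟨i₁, fun i hi => ?_⟩
  change N' i₁ = N' i
  refine le_antisymm (fun y hy => ?_) (hN' hi)
  obtain ⟨n, hn⟩ := hx y
  induction n generalizing y with
  | zero =>
    rw [pow_zero, one_smul] at hn
    rw [hn]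
    exact zero_mem _
  | succ n ih =>
    -- Equal layers give z in the smaller submodule with x^n y = x^n z, so the induction applies to
    -- y - z.
    have h1 : x ^ n • y ∈ L i₁ n := by
      refine ⟨⟨y, hy, rfl⟩, ?_⟩
      rw [SetLike.mem_coe, Submodule.mem_torsionBy_iff, ← mul_smul, ← pow_succ', hn]
    rw [hi₁ i hi n] at h1
    obtain ⟨⟨z, hz, hzy⟩, -⟩ := h1
    have h2 := ih (y - z) (sub_mem hy (hN' hi hz)) (by
      rw [smul_sub, sub_eq_zero]
      exact hzy.symm)
    have := add_mem h2 hz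
    rwa [sub_add_cancel] at this

/-- The elements of S are treated one at a time: the part of M[x] killed by S embeds into the part
of M killed by S and x. -/
theorem isArtinian_of_torsionBySet (S : Finset R) (M : Type*) [AddCommGroup M] [Module R M]
    (hS : ∀ x ∈ S, ∀ m : M, ∃ n : ℕ, x ^ n • m = 0)
    (h : IsArtinian R (Submodule.torsionBySet R M (S : Set R))) : IsArtinian R M := by
  classical
  induction S using Finset.induction_on generalizing M with
  | empty =>
    have h0 : Submodule.torsionBySet R M ((∅ : Finset R) : Set R) = ⊤ :=
      eq_top_iff.2 fun m _ => by simp [Submodule.mem_torsionBySet_iff]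
    rw [h0] at h
    exact isArtinian_of_linearEquiv Submodule.topEquiv
  | insert x S hxS ih =>
    refine isArtinian_of_torsionBy x (hS x (Finset.mem_insert_self _ _)) ?_
    refine ih _ (fun y hy m => ?_) ?_
    · obtain ⟨n, hn⟩ := hS y (Finset.mem_insert_of_mem hy) m.1
      exact ⟨n, Subtype.ext hn⟩
    · refine isArtinian_of_injective
        (LinearMap.codRestrict (Submodule.torsionBySet R M ((insert x S : Finset R) : Set R))
          ((Submodule.torsionBy R M x).subtype ∘ₗ
            (Submodule.torsionBySet R (Submodule.torsionBy R M x) (S : Set R)).subtype)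
          (fun m => ?_)) ?_
      · rw [Submodule.mem_torsionBySet_iff]
        rintro ⟨y, hy⟩
        rcases Finset.mem_insert.1 (Finset.mem_coe.1 hy) with rfl | hy
        · exact m.1.2
        · exact congrArg Subtype.val ((Submodule.mem_torsionBySet_iff _ _).1 m.2 ⟨y, hy⟩)
      · intro m m' hmm
        have h' := congrArg Subtype.val hmm
        exact Subtype.ext (Subtype.ext h')

end Artinian

/-! ### The injective hull of the residue field -/

section Hull

open IsLocalRing

variable {R : Type u} [CommRing R] [IsLocalRing R] {E : Type u} [AddCommGroup E] [Module R E]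
  {ι : ResidueField R →ₗ[R] E}

theorem IsInjectiveHull.exists_smul_ne_zero (hι : IsInjectiveHull ι) {e : E} (he : e ≠ 0) :
    ∃ r : R, r • e ≠ 0 ∧ r • e ∈ LinearMap.range ι := by
  by_contra! hcon
  have := hι.essential (Submodule.span R {e}) (by
    rw [eq_bot_iff]
    rintro y ⟨hy, hy'⟩
    obtain ⟨r, rfl⟩ := Submodule.mem_span_singleton.1 hy
    by_contra hne
    exact hcon r hne hy')
  exact he (Submodule.span_singleton_eq_bot.1 this)

theorem smul_residueField_eq_zero {x : R} (hx : x ∈ maximalIdeal R) (c : ResidueField R) :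
    x • c = 0 := by
  rw [Algebra.smul_def, ResidueField.algebraMap_eq, (residue_eq_zero_iff x).2 hx, zero_mul]

theorem smul_range_eq_zero {x : R} (hx : x ∈ maximalIdeal R) {e : E}
    (he : e ∈ LinearMap.range ι) : x • e = 0 := by
  obtain ⟨c, rfl⟩ := he
  rw [← map_smul, smul_residueField_eq_zero hx, map_zero]

/-- By essentiality a nonzero e has a nonzero multiple re in the image of k. If the maximal ideal
kills e, then r must be a unit. -/
theorem IsInjectiveHull.mem_range_of_forall_smul (hι : IsInjectiveHull ι) {e : E}
    (he : ∀ x ∈ maximalIdeal R, x • e = 0) : e ∈ LinearMap.range ι := by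
  rcases eq_or_ne e 0 with rfl | hne
  · exact zero_mem _
  · obtain ⟨r, hr, hr'⟩ := hι.exists_smul_ne_zero hne
    have hu : IsUnit r := by
      by_contra hu
      exact hr (he r ((mem_maximalIdeal r).2 hu))
    obtain ⟨u, rfl⟩ := hu
    have := (LinearMap.range ι).smul_mem ((u⁻¹ : Rˣ) : R) hr'
    rwa [← mul_smul, Units.inv_mul, one_smul] at this

/-- For x in the maximal ideal the annihilators of x^n e stabilize. If x^n e stayed nonzero, a
nonzero multiple r x^n e would lie in the image of k and be killed by x, so r would annihilate
x^(n+1) e but not x^n e. Hence the maximal ideal lies in the radical of Ann e. -/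
theorem IsInjectiveHull.isPowTorsion [IsNoetherianRing R] (hι : IsInjectiveHull ι) :
    IsPowTorsion (maximalIdeal R) E := by
  intro e
  have hrad : maximalIdeal R ≤ Ideal.radical (LinearMap.ker (LinearMap.toSpanSingleton R E e)) := by
    intro x hx
    obtain ⟨n, hn⟩ := monotone_stabilizes_iff_noetherian.2 (inferInstance : IsNoetherian R R)
      ⟨fun n => LinearMap.ker (LinearMap.toSpanSingleton R E (x ^ n • e)),
        monotone_nat_of_le_succ fun n r hr => by
          rw [LinearMap.mem_ker, LinearMap.toSpanSingleton_apply] at hr ⊢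
          rw [pow_succ', mul_smul, smul_comm, hr, smul_zero]⟩
    refine ⟨n, ?_⟩
    rw [LinearMap.mem_ker, LinearMap.toSpanSingleton_apply]
    by_contra hne
    obtain ⟨r, hr, hr'⟩ := hι.exists_smul_ne_zero hne
    have h1 : r ∈ LinearMap.ker (LinearMap.toSpanSingleton R E (x ^ (n + 1) • e)) := by
      rw [LinearMap.mem_ker, LinearMap.toSpanSingleton_apply, pow_succ', mul_smul, smul_comm]
      exact smul_range_eq_zero hx hr'
    have h2 := hn (n + 1) (Nat.le_succ n)
    change LinearMap.ker (LinearMap.toSpanSingleton R E (x ^ n • e)) =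
      LinearMap.ker (LinearMap.toSpanSingleton R E (x ^ (n + 1) • e)) at h2
    rw [← h2] at h1
    exact hr h1
  obtain ⟨n, hn⟩ := Ideal.exists_pow_le_of_le_radical_of_fg hrad
    (IsNoetherian.noetherian (maximalIdeal R))
  exact ⟨n, fun x hx => hn hx⟩

/-- E is a cogenerator: Ann x is proper, so R → k → E factors through the cyclic module Rx, and
injectivity extends the resulting map to X. -/
theorem IsInjectiveHull.exists_apply_ne_zero (hι : IsInjectiveHull ι) {X : Type u}
    [AddCommGroup X] [Module R X] {x : X} (hx : x ≠ 0) : ∃ f : X →ₗ[R] E, f x ≠ 0 := by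
  obtain ⟨χ, hχ⟩ := exists_comp_eq_of_exact hι.injective_module
    (LinearMap.ker (LinearMap.toSpanSingleton R X x)).subtype (LinearMap.toSpanSingleton R X x)
    (by rw [Submodule.range_subtype]) (ι ∘ₗ Algebra.linearMap R (ResidueField R)) (by
      ext ⟨r, hr⟩
      have hr' : r • x = 0 := hr
      have hm : r ∈ maximalIdeal R := by
        rw [mem_maximalIdeal]
        rintro ⟨u, rfl⟩
        exact hx (by simpa using congrArg (fun y => ((u⁻¹ : Rˣ) : R) • y) hr')
      change ι (algebraMap R _ r) = 0
      rw [ResidueField.algebraMap_eq, (residue_eq_zero_iff r).2 hm, map_zero])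
  refine ⟨χ, fun h0 => ?_⟩
  have h1 := LinearMap.congr_fun hχ 1
  rw [LinearMap.comp_apply, LinearMap.toSpanSingleton_apply, one_smul, h0] at h1
  have h2 : ι 1 = 0 := by simpa using h1.symm
  exact one_ne_zero (hι.injective_map (h2.trans (map_zero ι).symm))

theorem IsInjectiveHull.exists_apply_ne_zero_of_notMem (hι : IsInjectiveHull ι) {X : Type u}
    [AddCommGroup X] [Module R X] (N : Submodule R X) {x : X} (hx : x ∉ N) :
    ∃ f : X →ₗ[R] E, (∀ y ∈ N, f y = 0) ∧ f x ≠ 0 := by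
  obtain ⟨f, hf⟩ := hι.exists_apply_ne_zero (x := N.mkQ x)
    (fun h => hx ((Submodule.Quotient.mk_eq_zero N).1 h))
  refine ⟨f ∘ₗ N.mkQ, fun y hy => ?_, hf⟩
  rw [LinearMap.comp_apply, Submodule.mkQ_apply, (Submodule.Quotient.mk_eq_zero N).2 hy, map_zero]

theorem IsInjectiveHull.exists_smul_eq_on_socle (hι : IsInjectiveHull ι) (f : E →ₗ[R] E) :
    ∃ r : R, ∀ e ∈ LinearMap.range ι, f e = r • e := by
  have h1 : f (ι 1) ∈ LinearMap.range ι := hι.mem_range_of_forall_smul fun x hx => by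
    rw [← map_smul, smul_range_eq_zero hx ⟨1, rfl⟩, map_zero]
  obtain ⟨c, hc⟩ := h1
  obtain ⟨r, rfl⟩ := residue_surjective c
  refine ⟨r, ?_⟩
  rintro _ ⟨d, rfl⟩
  obtain ⟨t, rfl⟩ := residue_surjective d
  have h2 : ∀ t : R, residue R t = t • (1 : ResidueField R) := fun t => by
    rw [Algebra.smul_def, mul_one, ResidueField.algebraMap_eq]
  rw [h2 t, map_smul, map_smul, ← hc, h2 r, map_smul, smul_comm]

/-- On the submodule of `E` annihilated by an ideal containing a power of the maximal ideal, every
endomorphism of `E` is the multiplication by an element of `R`. -/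
theorem IsInjectiveHull.exists_smul_eq_of_pow_le [IsNoetherianRing R] (hι : IsInjectiveHull ι)
    (K : Ideal R) (n : ℕ) (hK : maximalIdeal R ^ n ≤ K) (f : E →ₗ[R] E) :
    ∃ r : R, ∀ e : E, (∀ x ∈ K, x • e = 0) → f e = r • e := by
  induction K using WellFoundedGT.induction generalizing f with
  | _ K ih =>
    by_cases hex : ∃ x, x ∉ K ∧ ∀ y ∈ maximalIdeal R, y * x ∈ K
    · obtain ⟨x, hxK, hx⟩ := hex
      have hlt : K < K ⊔ Ideal.span {x} := by
        refine lt_of_le_of_ne le_sup_left fun heq => hxK ?_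
        rw [heq]
        exact Ideal.mem_sup_right (Ideal.mem_span_singleton_self x)
      obtain ⟨r, hr⟩ := ih _ hlt (hK.trans hlt.le) f
      let EK : Submodule R E := Submodule.torsionBySet R E (K : Set R)
      have hEK : ∀ e : E, (∀ x ∈ K, x • e = 0) ↔ e ∈ EK := fun e => by
        simp [EK, Submodule.mem_torsionBySet_iff]
      let g : EK →ₗ[R] E := LinearMap.lsmul R E x ∘ₗ EK.subtype
      obtain ⟨h, hh⟩ := exists_comp_eq_of_exact hι.injective_module
        (LinearMap.ker g).subtype g (by rw [Submodule.range_subtype])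
        ((f - LinearMap.lsmul R E r) ∘ₗ EK.subtype) (by
          ext ⟨e, he⟩
          have hxe : x • e.1 = 0 := he
          have := hr e.1 (fun z hz => by
            obtain ⟨y, hy, w, hw, rfl⟩ := Submodule.mem_sup.1 hz
            obtain ⟨c, rfl⟩ := Ideal.mem_span_singleton'.1 hw
            rw [add_smul, mul_smul, hxe, smul_zero, add_zero]
            exact (hEK _).2 e.2 y hy)
          simp [this])
      obtain ⟨r', hr'⟩ := hι.exists_smul_eq_on_socle h
      refine ⟨r + r' * x, fun e he => ?_⟩
      have h1 := LinearMap.congr_fun hh ⟨e, (hEK e).1 he⟩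
      have h2 : h (x • e) = r' • x • e := hr' _ (hι.mem_range_of_forall_smul fun y hy => by
        rw [← mul_smul]
        exact he _ (hx y hy))
      have h3 : h (x • e) = f e - r • e := h1
      rw [add_smul, mul_smul, ← h2, h3, add_sub_cancel]
    · push Not at hex
      -- If R/K has no socle, then K contains smaller and smaller powers of the maximal ideal, hence
      -- 1.
      have htop : ∀ m, maximalIdeal R ^ m ≤ K → (1 : R) ∈ K := by
        intro m
        induction m with
        | zero => intro h; exact h (by simp)
        | succ m ihm =>
          intro h
          refine ihm fun x hx => ?_
          by_contra hxK
          obtain ⟨y, hy, hyx⟩ := hex x hxK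
          exact hyx (h (by rw [pow_succ']; exact Ideal.mul_mem_mul hy hx))
      refine ⟨0, fun e he => ?_⟩
      have : e = 0 := by simpa using he 1 (htop n hK)
      simp [this]

/-- Every endomorphism of `E` is the multiplication by an element of the completion of `R`. -/
theorem IsInjectiveHull.exists_torsionSMul_eq [IsNoetherianRing R] (hι : IsInjectiveHull ι)
    (f : E →ₗ[R] E) : ∃ s : AdicCompletion (maximalIdeal R) R,
      ∀ e, f e = torsionSMul hι.isPowTorsion s e := by
  choose r hr using fun n => hι.exists_smul_eq_of_pow_le (maximalIdeal R ^ n) n le_rfl f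
  -- A map g from R/𝔪^m to E sends 1 to an element killed by 𝔪^m, on which `r m` and `r n` both act
  -- as f. Such maps separate the points of R/𝔪^m, so the scalars are congruent and form a Cauchy
  -- sequence.
  have hc : ∀ m n, m ≤ n → r m - r n ∈ maximalIdeal R ^ m := by
    intro m n hmn
    by_contra hcon
    obtain ⟨g, hg⟩ := hι.exists_apply_ne_zero (x := (maximalIdeal R ^ m).mkQ (r m - r n))
      (fun h => hcon ((Submodule.Quotient.mk_eq_zero _).1 h))
    apply hg
    have h1 : ∀ x : R, g ((maximalIdeal R ^ m).mkQ x) = x • g ((maximalIdeal R ^ m).mkQ 1) :=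
      fun x => by rw [← map_smul, ← map_smul, smul_eq_mul, mul_one]
    have h2 : ∀ x ∈ maximalIdeal R ^ m, x • g ((maximalIdeal R ^ m).mkQ 1) = 0 := fun x hx => by
      rw [← h1, Submodule.mkQ_apply, (Submodule.Quotient.mk_eq_zero _).2 hx, map_zero]
    rw [h1, sub_smul, ← hr m _ h2, ← hr n _ fun x hx => h2 x (Ideal.pow_le_pow_right hmn hx),
      sub_self]
  let b : AdicCompletion.AdicCauchySequence (maximalIdeal R) R := ⟨r, fun {m n} hmn => by
    rw [SModEq.sub_mem, smul_eq_mul, Ideal.mul_top]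
    exact hc m n hmn⟩
  refine ⟨AdicCompletion.mk _ _ b, fun e => ?_⟩
  obtain ⟨n, hn⟩ := hι.isPowTorsion e
  rw [hr n e hn, torsionSMul_eq hι.isPowTorsion hn (AdicCompletion.evalₐ_mk _ n b)]

theorem isArtinian_range (ι : ResidueField R →ₗ[R] E) : IsArtinian R (LinearMap.range ι) := by
  have : IsArtinian R (ResidueField R) := by
    have : IsSimpleModule R (R ⧸ maximalIdeal R) :=
      isSimpleModule_iff_isCoatom.2 (maximalIdeal.isMaximal R).out
    exact (inferInstance : IsArtinian R (R ⧸ maximalIdeal R))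
  exact isArtinian_of_surjective _ ι.rangeRestrict ι.surjective_rangeRestrict

/-- Generators of the maximal ideal act locally nilpotently on E, and their common kernel is the
socle k, which is artinian. -/
theorem IsInjectiveHull.isArtinian [IsNoetherianRing R] (hι : IsInjectiveHull ι) :
    IsArtinian R E := by
  obtain ⟨S, hS⟩ := IsNoetherian.noetherian (maximalIdeal R)
  have hSm : ∀ x ∈ S, x ∈ maximalIdeal R := fun x hx => hS ▸ Submodule.subset_span hx
  refine isArtinian_of_torsionBySet S E (fun x hx e => ?_) ?_
  · obtain ⟨n, hn⟩ := hι.isPowTorsion e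
    exact ⟨n, hn _ (Ideal.pow_mem_pow (hSm x hx) n)⟩
  · have hle : Submodule.torsionBySet R E (S : Set R) ≤ LinearMap.range ι := by
      intro e he
      refine hι.mem_range_of_forall_smul fun x hx => ?_
      rw [Submodule.torsionBySet_eq_torsionBySet_span, Ideal.span, hS] at he
      exact (Submodule.mem_torsionBySet_iff _ _).1 he ⟨x, hx⟩
    have := isArtinian_range ι
    exact isArtinian_of_injective (Submodule.inclusion hle) (Submodule.inclusion_injective hle)

/-- An artinian module embeds into a finite power of `E`. -/
theorem IsInjectiveHull.exists_injective_pi (hι : IsInjectiveHull ι) (A : Type u)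
    [AddCommGroup A] [Module R A] [IsArtinian R A] :
    ∃ (n : ℕ) (t : A →ₗ[R] (Fin n → E)), Function.Injective t := by
  -- Take a map to a finite power with minimal kernel; a nonzero x in the kernel would be detected
  -- by one more coordinate.
  obtain ⟨N, ⟨⟨n, t⟩, rfl⟩, hmin⟩ := IsArtinian.set_has_minimal (R := R) (M := A)
    (Set.range fun p : Σ n : ℕ, A →ₗ[R] (Fin n → E) => LinearMap.ker p.2) ⟨_, ⟨0, 0⟩, rfl⟩
  refine ⟨n, t, LinearMap.ker_eq_bot.1 (eq_bot_iff.2 fun x hx => ?_)⟩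
  by_contra hne
  obtain ⟨f, hf⟩ := hι.exists_apply_ne_zero (x := x) hne
  let t' : A →ₗ[R] (Fin (n + 1) → E) :=
    LinearMap.pi (Fin.cons f fun i => LinearMap.proj i ∘ₗ t)
  have hle : LinearMap.ker t' ≤ LinearMap.ker t := fun y hy => by
    rw [LinearMap.mem_ker] at hy ⊢
    ext i
    simpa [t'] using congrFun hy i.succ
  refine hmin _ ⟨⟨n + 1, t'⟩, rfl⟩ (lt_of_le_of_ne hle fun heq => hf ?_)
  have hx' : x ∈ LinearMap.ker t' := by
    change LinearMap.ker t' = LinearMap.ker t at heq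
    rwa [heq]
  simpa [t'] using congrFun (LinearMap.mem_ker.1 hx') 0

theorem IsInjectiveHull.isPowTorsion_of_isArtinian [IsNoetherianRing R] (hι : IsInjectiveHull ι)
    (A : Type u) [AddCommGroup A] [Module R A] [IsArtinian R A] :
    IsPowTorsion (maximalIdeal R) A := by
  obtain ⟨n, t, ht⟩ := hι.exists_injective_pi A
  intro v
  choose m hm using fun i => hι.isPowTorsion (t v i)
  refine ⟨Finset.univ.sup m, fun x hx => ht ?_⟩
  rw [map_smul, map_zero]
  ext i
  exact hm i x (Ideal.pow_le_pow_right (Finset.le_sup (Finset.mem_univ i)) hx)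

end Hull

/-! ### Module structures over the completion -/

section Structures

variable {R : Type u} [CommRing R] {a : Ideal R}

theorem smul_eq_zero_of_mem_map {L : Type*} [AddCommGroup L] [Module R L]
    [Module (AdicCompletion a R) L] [IsScalarTower R (AdicCompletion a R) L] {I : Ideal R} {l : L}
    (hl : ∀ x ∈ I, x • l = 0) {t : AdicCompletion a R}
    (ht : t ∈ I.map (algebraMap R (AdicCompletion a R))) : t • l = 0 := by
  induction ht using Submodule.span_induction with
  | mem x hx =>
    obtain ⟨x, hx, rfl⟩ := hx
    rw [algebraMap_smul, hl x hx]
  | zero => rw [zero_smul]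
  | add x y _ _ hx hy => rw [add_smul, hx, hy, add_zero]
  | smul s x _ hx => rw [smul_assoc, hx, smul_zero]

theorem smul_eq_smul_of_sub_mem_map {L : Type*} [AddCommGroup L] [Module R L]
    [Module (AdicCompletion a R) L] [IsScalarTower R (AdicCompletion a R) L] {I : Ideal R} {l : L}
    (hl : ∀ x ∈ I, x • l = 0) {s : AdicCompletion a R} {r : R}
    (ht : s - algebraMap R _ r ∈ I.map (algebraMap R (AdicCompletion a R))) : s • l = r • l := by
  rw [← sub_eq_zero, ← algebraMap_smul (AdicCompletion a R) r l, ← sub_smul]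
  exact smul_eq_zero_of_mem_map hl ht

theorem map_completion_smul {L L' : Type*} [AddCommGroup L] [Module R L]
    [Module (AdicCompletion a R) L] [IsScalarTower R (AdicCompletion a R) L]
    [AddCommGroup L'] [Module R L'] [Module (AdicCompletion a R) L']
    [IsScalarTower R (AdicCompletion a R) L'] {I : Ideal R} (hI : IsSurjectiveModulo a I)
    (hl : ∀ x ∈ I, ∀ l : L, x • l = 0) (f : L →ₗ[R] L') (s : AdicCompletion a R) (l : L) :
    f (s • l) = s • f l := by
  obtain ⟨r, hr⟩ := hI s
  rw [smul_eq_smul_of_sub_mem_map (fun x hx => hl x hx l) hr, map_smul,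
    smul_eq_smul_of_sub_mem_map (fun x hx => by rw [← map_smul, hl x hx, map_zero]) hr]

theorem torsionSMul_eq_smul [IsNoetherianRing R] {V : Type*} [AddCommGroup V] [Module R V]
    [Module (AdicCompletion a R) V] [IsScalarTower R (AdicCompletion a R) V]
    (hV : IsPowTorsion a V) (s : AdicCompletion a R) (v : V) : torsionSMul hV s v = s • v := by
  obtain ⟨n, hn, r, hr, h⟩ := exists_torsionSMul_eq hV v s
  rw [h, smul_eq_smul_of_sub_mem_map hn (sub_mem_map_pow a hr)]

/-- Choose r with (s - r)u = 0 and write s - r = q + t with q in R and t in a^n R^. Then tu = xu for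
some x in a^n, so x + q annihilates u and represents s - r modulo a^n. Since the extension of Ann u
to R^ is closed, s - r belongs to it. -/
theorem IsSurjectiveModulo.of_forall_smul_eq [IsNoetherianRing R] {U : Type*} [AddCommGroup U]
    [Module R U] [Module (AdicCompletion a R) U] [IsScalarTower R (AdicCompletion a R) U] {u : U}
    (hu : ∀ s : AdicCompletion a R, ∃ r : R, s • u = r • u) :
    IsSurjectiveModulo a (LinearMap.ker (LinearMap.toSpanSingleton R U u)) := by
  have key : ∀ (J : Ideal R) (t), t ∈ J.map (algebraMap R (AdicCompletion a R)) →
      ∃ x ∈ J, t • u = x • u := by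
    intro J t ht
    induction ht using Submodule.span_induction with
    | mem x hx =>
      obtain ⟨x, hx, rfl⟩ := hx
      exact ⟨x, hx, algebraMap_smul _ x u⟩
    | zero => exact ⟨0, zero_mem _, by simp⟩
    | add x y _ _ hx hy =>
      obtain ⟨x', hx', hx⟩ := hx
      obtain ⟨y', hy', hy⟩ := hy
      exact ⟨x' + y', add_mem hx' hy', by rw [add_smul, hx, hy, add_smul]⟩
    | smul s x _ hx =>
      obtain ⟨x', hx', hx⟩ := hx
      obtain ⟨r, hr⟩ := hu s
      refine ⟨x' * r, Ideal.mul_mem_right _ _ hx', ?_⟩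
      rw [smul_assoc, hx, smul_comm, hr, mul_smul]
  intro s
  obtain ⟨r, hr⟩ := hu s
  refine ⟨r, mem_map_of_forall_evalₐ_mem _ _ _ fun n => ?_⟩
  obtain ⟨q, hq⟩ := exists_evalₐ_eq_mk (s - algebraMap R _ r) n
  obtain ⟨x, hx, hxu⟩ := key _ _ (sub_mem_map_pow a hq)
  have h0 : (x + q) • u = 0 := by
    rw [add_smul, ← hxu, sub_smul, sub_smul, algebraMap_smul, algebraMap_smul, hr, sub_self,
      zero_sub, neg_add_cancel]
  have h1 : Ideal.Quotient.mk (a ^ n) q = Ideal.Quotient.mk (a ^ n) (x + q) := by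
    rw [map_add, Ideal.Quotient.eq_zero_iff_mem.2 hx, zero_add]
  rw [hq, h1]
  exact Ideal.mem_map_of_mem _ h0

end Structures

/-! ### Uniqueness of completion structures over a local ring -/

section LocalStructures

open IsLocalRing

variable {R : Type u} [CommRing R] [IsLocalRing R]

theorem CompletionStructure.ext_smul {L : Type u} [AddCommGroup L] [Module R L]
    (S S' : CompletionStructure R L)
    (h : ∀ (s : AdicCompletion (maximalIdeal R) R) (l : L),
      S.module.smul s l = S'.module.smul s l) : S = S' := by
  obtain ⟨m, hm⟩ := S
  obtain ⟨m', hm'⟩ := S'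
  have : m = m' := Module.ext (by
    ext s l
    exact h s l)
  subst this
  rfl

theorem completionHomInclusion_bijective {L L' : Type u} [AddCommGroup L] [Module R L]
    [AddCommGroup L'] [Module R L'] {I : Ideal R} (hI : IsSurjectiveModulo (maximalIdeal R) I)
    (hl : ∀ x ∈ I, ∀ l : L, x • l = 0) (S : CompletionStructure R L)
    (S' : CompletionStructure R L') : Function.Bijective (completionHomInclusion R S S') := by
  let := S.module
  let := S'.module
  have := S.isScalarTower
  have := S'.isScalarTower
  constructor
  · intro f g hfg
    ext x
    exact LinearMap.congr_fun hfg x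
  · intro f
    exact ⟨{ f with map_smul' := fun s l => map_completion_smul hI hl f s l }, rfl⟩

variable {E : Type u} [AddCommGroup E] [Module R E] {ι : ResidueField R →ₗ[R] E}

/-- If su were not in Ru, a functional f on the power of U would kill u but not su. Such f is a sum
of functionals of single coordinates, each commuting with s, so f(su) = s f(u) = 0. -/
theorem IsInjectiveHull.exists_smul_eq_smul_pi (hι : IsInjectiveHull ι)
    [Module (AdicCompletion (maximalIdeal R) R) E]
    {U : Type u} [AddCommGroup U] [Module R U] [Module (AdicCompletion (maximalIdeal R) R) U]
    (hU : ∀ (F : U →ₗ[R] E) (s : AdicCompletion (maximalIdeal R) R) (u : U), F (s • u) = s • F u)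
    {n : ℕ} (u : Fin n → U) (s : AdicCompletion (maximalIdeal R) R) :
    ∃ r : R, s • u = r • u := by
  by_contra hcon
  obtain ⟨f, hf, hfs⟩ := hι.exists_apply_ne_zero_of_notMem (Submodule.span R {u}) (x := s • u)
    (fun h => hcon (by
      obtain ⟨r, hr⟩ := Submodule.mem_span_singleton.1 h
      exact ⟨r, hr.symm⟩))
  apply hfs
  have h1 : ∀ v : Fin n → U, f v = ∑ i, f (Pi.single i (v i)) := fun v => by
    rw [← map_sum, Finset.univ_sum_single]
  have h2 : f (s • u) = s • f u := by
    rw [h1, h1 u, Finset.smul_sum]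
    refine Finset.sum_congr rfl fun i _ => ?_
    exact hU (f ∘ₗ LinearMap.single R (fun _ => U) i) s (u i)
  rw [h2, hf u (Submodule.mem_span_singleton_self u), smul_zero]

variable [IsNoetherianRing R]

/-- Any compatible structure is forced: s differs from an element of R by an element of 𝔪^n R^,
which kills v once 𝔪^n does. -/
theorem nonempty_unique_of_isPowTorsion {V : Type u} [AddCommGroup V] [Module R V]
    (hV : IsPowTorsion (maximalIdeal R) V) : Nonempty (Unique (CompletionStructure R V)) := by
  refine ⟨⟨⟨⟨torsionModule hV, torsionModule_isScalarTower hV⟩⟩, fun S => ?_⟩⟩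
  apply CompletionStructure.ext_smul
  intro s v
  let := S.module
  have := S.isScalarTower
  exact (torsionSMul_eq_smul hV s v).symm

/-- R/I is 𝔪-adically separated by Krull's intersection theorem, and membership in IR^ gives
membership in I + 𝔪^n for every n. -/
theorem mem_of_algebraMap_mem_map {I : Ideal R} {r : R}
    (h : algebraMap R _ r ∈ I.map (algebraMap R (AdicCompletion (maximalIdeal R) R))) :
    r ∈ I := by
  have hH : IsHausdorff (maximalIdeal R) (R ⧸ I) := inferInstance
  rw [← Submodule.Quotient.mk_eq_zero]
  refine hH.haus _ fun n => ?_
  have h2 := Ideal.mem_map_of_mem (AdicCompletion.evalₐ (maximalIdeal R) n).toRingHom h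
  have hcomp : (AdicCompletion.evalₐ (maximalIdeal R) n).toRingHom.comp
      (algebraMap R (AdicCompletion (maximalIdeal R) R)) =
        Ideal.Quotient.mk (maximalIdeal R ^ n) := RingHom.ext fun x => evalₐ_algebraMap x n
  rw [Ideal.map_map, ← RingHom.comp_apply, hcomp] at h2
  rw [Ideal.mem_map_iff_of_surjective _ Ideal.Quotient.mk_surjective] at h2
  obtain ⟨x, hx, hxr⟩ := h2
  rw [Ideal.Quotient.mk_eq_mk_iff_sub_mem] at hxr
  rw [SModEq.zero]
  have h3 : (Submodule.Quotient.mk r : R ⧸ I) = (-(x - r)) • Submodule.Quotient.mk 1 := by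
    rw [← Submodule.Quotient.mk_smul, smul_eq_mul, mul_one, neg_sub, Submodule.Quotient.mk_sub,
      (Submodule.Quotient.mk_eq_zero I).2 hx, sub_zero]
  rw [h3]
  exact Submodule.smul_mem_smul (neg_mem hxr) trivial

/-- R/I → R^/IR^ is bijective, so the R/I-structure of L pulls back to R^. In any compatible
structure s acts as an element r of R with s - r in IR^. -/
theorem nonempty_unique_of_isSurjectiveModulo {L : Type u} [AddCommGroup L] [Module R L]
    {I : Ideal R} (hI : IsSurjectiveModulo (maximalIdeal R) I)
    (hl : ∀ x ∈ I, ∀ l : L, x • l = 0) : Nonempty (Unique (CompletionStructure R L)) := by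
  let Rh := AdicCompletion (maximalIdeal R) R
  let f : R ⧸ I →+* Rh ⧸ I.map (algebraMap R Rh) :=
    Ideal.quotientMap _ (algebraMap R Rh) Ideal.le_comap_map
  have hf : Function.Bijective f := by
    constructor
    · refine (injective_iff_map_eq_zero f).2 fun x hx => ?_
      obtain ⟨r, rfl⟩ := Ideal.Quotient.mk_surjective x
      rw [Ideal.quotientMap_mk, Ideal.Quotient.eq_zero_iff_mem] at hx
      exact Ideal.Quotient.eq_zero_iff_mem.2 (mem_of_algebraMap_mem_map hx)
    · intro y
      obtain ⟨s, rfl⟩ := Ideal.Quotient.mk_surjective y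
      obtain ⟨r, hr⟩ := hI s
      refine ⟨Ideal.Quotient.mk _ r, ?_⟩
      rw [Ideal.quotientMap_mk, eq_comm, Ideal.Quotient.mk_eq_mk_iff_sub_mem]
      exact hr
  let g : Rh →+* R ⧸ I :=
    (RingEquiv.ofBijective f hf).symm.toRingHom.comp (Ideal.Quotient.mk _)
  have hg : ∀ r : R, g (algebraMap R Rh r) = Ideal.Quotient.mk I r := fun r =>
    (RingEquiv.ofBijective f hf).symm_apply_eq.2 rfl
  let mI : Module (R ⧸ I) L :=
    Module.IsTorsionBySet.module (I := I) (fun l x => hl x.1 x.2 l)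
  let mL : Module Rh L := Module.compHom L g
  have hL : IsScalarTower R Rh L := IsScalarTower.of_algebraMap_smul fun r l => by
    change g (algebraMap R Rh r) • l = r • l
    rw [hg]
    rfl
  refine ⟨⟨⟨⟨mL, hL⟩⟩, fun S => ?_⟩⟩
  apply CompletionStructure.ext_smul
  intro s l
  obtain ⟨r, hr⟩ := hI s
  have h1 : ∀ S : CompletionStructure R L, S.module.smul s l = r • l := fun S => by
    let := S.module
    have := S.isScalarTower
    exact smul_eq_smul_of_sub_mem_map (fun x hx => hl x hx l) hr
  rw [h1, h1]

/-! ### Matlis reflexive modules -/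

/-- R^ acts on M^∨ and M^∨∨ through E. Reflexivity makes every R-linear functional on either of them
R^-linear, so for a finite tuple u from one of them R^u = Ru, and R^ = R + (Ann u)R^. Suitable
tuples have annihilator inside Ann(M/N) and Ann N, and the product of these ideals kills M. -/
theorem IsMatlisReflexive.isSurjectiveModulo (hι : IsInjectiveHull ι) {M : Type u}
    [AddCommGroup M] [Module R M] (hM : IsMinimax R M) (hr : IsMatlisReflexive R E M) :
    IsSurjectiveModulo (maximalIdeal R) (Module.annihilator R M) := by
  obtain ⟨N, hN, hA⟩ := hM
  let : Module (AdicCompletion (maximalIdeal R) R) E := torsionModule hι.isPowTorsion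
  have : IsScalarTower R (AdicCompletion (maximalIdeal R) R) E :=
    torsionModule_isScalarTower hι.isPowTorsion
  obtain ⟨n, t, ht⟩ := hι.exists_injective_pi (M ⧸ N)
  -- The tuple in M^∨ consists of the coordinates of M → M/N → E^n. Functionals on M^∨ are
  -- evaluations at elements of M.
  have hann : IsSurjectiveModulo (maximalIdeal R) (Module.annihilator R (M ⧸ N)) := by
    refine (IsSurjectiveModulo.of_forall_smul_eq (U := Fin n → (M →ₗ[R] E))
      (hι.exists_smul_eq_smul_pi (fun F s ψ => ?_)
        (fun i => LinearMap.proj i ∘ₗ t ∘ₗ N.mkQ))).mono fun r hr => ?_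
    · obtain ⟨x, rfl⟩ := hr.2 F
      rfl
    · rw [Module.mem_annihilator]
      intro y
      obtain ⟨x, rfl⟩ := N.mkQ_surjective y
      apply ht
      rw [map_smul, map_zero]
      ext i
      exact LinearMap.congr_fun (congrFun (LinearMap.mem_ker.1 hr) i) x
  -- The tuple in M^∨∨ consists of the images of generators of N. For a functional F, both ξ and sξ
  -- are evaluations, and applying them to F ∘ `biduality` gives linearity of F.
  have hann' : IsSurjectiveModulo (maximalIdeal R) N.annihilator := by
    obtain ⟨m, x, hx⟩ := Submodule.fg_iff_exists_fin_generating_family.1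
      (Module.Finite.iff_fg.1 (inferInstance : Module.Finite R N))
    refine (IsSurjectiveModulo.of_forall_smul_eq (U := Fin m → ((M →ₗ[R] E) →ₗ[R] E))
      (hι.exists_smul_eq_smul_pi (fun F s ξ => ?_)
        (fun i => biduality R E M (x i)))).mono fun r hr' => ?_
    · obtain ⟨y, hy⟩ := hr.2 (s • ξ)
      obtain ⟨z, rfl⟩ := hr.2 ξ
      rw [← hy]
      exact LinearMap.congr_fun hy (F ∘ₗ biduality R E M)
    · rw [← hx, Submodule.mem_annihilator_span]
      rintro ⟨_, i, rfl⟩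
      apply hr.1
      rw [map_smul, map_zero]
      exact congrFun (LinearMap.mem_ker.1 hr') i
  refine (hann'.mul hann).mono (Ideal.mul_le.2 fun p hp q hq => ?_)
  rw [Module.mem_annihilator]
  intro x
  rw [mul_smul]
  refine Submodule.mem_annihilator.1 hp _ ?_
  rw [← Submodule.Quotient.mk_eq_zero, Submodule.Quotient.mk_smul]
  exact Module.mem_annihilator.1 hq _

end LocalStructures

/-! ### The Hom-evaluation map -/

section HomEval

open TensorProduct

variable {R : Type u} [CommRing R] {L K J E : Type u} [AddCommGroup L] [Module R L]
  [AddCommGroup K] [Module R K] [AddCommGroup J] [Module R J] [AddCommGroup E] [Module R E]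

theorem homEval_rTensor (f : K →ₗ[R] L) (x : K ⊗[R] (J →ₗ[R] E)) (φ : L →ₗ[R] J) :
    homEval L J E (f.rTensor _ x) φ = homEval K J E x (φ ∘ₗ f) := by
  induction x using TensorProduct.induction_on with
  | zero => simp
  | add x y hx hy => rw [map_add, map_add, LinearMap.add_apply, hx, hy, map_add]; rfl
  | tmul k ψ => rfl

/-- Values on n generators embed Hom(L, J) into J^n. A functional extends to J^n by injectivity of
E, and there it is a sum of functionals of the coordinates. -/
theorem homEval_surjective_of_finite (hE : Module.Injective R E) [Module.Finite R L] :
    Function.Surjective (homEval (R := R) L J E) := by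
  obtain ⟨n, p, hp⟩ := Module.Finite.exists_fin' R L
  intro g
  let c : (L →ₗ[R] J) →ₗ[R] (Fin n → J) :=
    LinearMap.pi fun j => LinearMap.applyₗ (p (Pi.single j 1))
  have hc : Function.Injective c := by
    intro φ φ' h
    refine (LinearMap.cancel_right hp).1 ?_
    refine LinearMap.pi_ext' fun j => LinearMap.ext_ring ?_
    exact congrFun h j
  obtain ⟨G, hG⟩ := Module.Injective.extension_property R E _ _ c hc g
  refine ⟨∑ j, p (Pi.single j 1) ⊗ₜ (G ∘ₗ LinearMap.single R (fun _ => J) j), ?_⟩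
  ext φ
  rw [map_sum, LinearMap.sum_apply, ← hG, LinearMap.comp_apply, ← Finset.univ_sum_single (c φ),
    map_sum]
  rfl

theorem exists_sum_tmul_eq {n : ℕ} (p : (Fin n → R) →ₗ[R] L) (hp : Function.Surjective p)
    {D : Type*} [AddCommGroup D] [Module R D] (x : L ⊗[R] D) :
    ∃ ψ : Fin n → D, x = ∑ j, p (Pi.single j 1) ⊗ₜ ψ j := by
  induction x using TensorProduct.induction_on with
  | zero => exact ⟨0, by simp⟩
  | add x y hx hy =>
    obtain ⟨ψ, rfl⟩ := hx
    obtain ⟨ψ', rfl⟩ := hy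
    exact ⟨ψ + ψ', by simp [tmul_add, Finset.sum_add_distrib]⟩
  | tmul l ψ =>
    obtain ⟨v, rfl⟩ := hp l
    refine ⟨fun j => v j • ψ, ?_⟩
    conv_lhs => rw [pi_eq_sum_univ' v]
    rw [map_sum, sum_tmul]
    refine Finset.sum_congr rfl fun j _ => ?_
    rw [map_smul, smul_tmul]

/-- A presentation R^m → R^n → L makes Hom(L, J) the kernel of T : J^n → J^m. If ∑ p(e_j) ⊗ ψ_j
evaluates to zero, the functional (ψ_j) on J^n vanishes on that kernel and factors through T. Moving
the matrix of T across the tensor product turns the sum into one over relations of L, which is zero.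
-/
theorem homEval_injective_of_finite [IsNoetherianRing R] (hE : Module.Injective R E)
    [Module.Finite R L] : Function.Injective (homEval (R := R) L J E) := by
  obtain ⟨n, p, hp⟩ := Module.Finite.exists_fin' R L
  obtain ⟨m, k, hk⟩ := Submodule.fg_iff_exists_fin_generating_family.1
    (IsNoetherian.noetherian (LinearMap.ker p))
  refine (injective_iff_map_eq_zero _).2 fun x hx => ?_
  obtain ⟨ψ, rfl⟩ := exists_sum_tmul_eq p hp x
  let c : (L →ₗ[R] J) →ₗ[R] (Fin n → J) :=
    LinearMap.pi fun j => LinearMap.applyₗ (p (Pi.single j 1))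
  let T : (Fin n → J) →ₗ[R] (Fin m → J) :=
    LinearMap.pi fun l => ∑ j, k l j • LinearMap.proj j
  let G : (Fin n → J) →ₗ[R] E := ∑ j, ψ j ∘ₗ LinearMap.proj j
  have hker : LinearMap.ker T ≤ LinearMap.range c := by
    intro v hv
    let φ' : (Fin n → R) →ₗ[R] J := ∑ j, (LinearMap.proj j).smulRight (v j)
    have hφ' : ∀ w, φ' w = ∑ j, w j • v j := fun w => by simp [φ']
    have hle : LinearMap.ker p ≤ LinearMap.ker φ' := by
      rw [← hk, Submodule.span_le]
      rintro _ ⟨l, rfl⟩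
      rw [SetLike.mem_coe, LinearMap.mem_ker, hφ']
      simpa [T] using congrFun (LinearMap.mem_ker.1 hv) l
    refine ⟨(LinearMap.ker p).liftQ φ' hle ∘ₗ
      (p.quotKerEquivOfSurjective hp).symm.toLinearMap, ?_⟩
    ext j
    have h1 : (p.quotKerEquivOfSurjective hp).symm (p (Pi.single j 1)) =
        Submodule.Quotient.mk (Pi.single j 1) := by
      rw [LinearEquiv.symm_apply_eq]
      rfl
    change (LinearMap.ker p).liftQ φ' hle
      ((p.quotKerEquivOfSurjective hp).symm (p (Pi.single j 1))) = v j
    rw [h1, Submodule.liftQ_apply, hφ']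
    simp [Pi.single_apply]
  have hG : G ∘ₗ c = 0 := by
    ext φ
    have := LinearMap.congr_fun hx φ
    rw [map_sum, LinearMap.sum_apply] at this
    rw [LinearMap.comp_apply, LinearMap.sum_apply]
    exact this
  obtain ⟨χ, hχ⟩ := exists_comp_eq_of_exact hE c T hker G hG
  have hψ : ∀ j, ψ j = ∑ l, k l j • (χ ∘ₗ LinearMap.single R (fun _ => J) l) := by
    intro j
    ext y
    have h1 : G (Pi.single j y) = ψ j y := by
      rw [LinearMap.sum_apply, Finset.sum_eq_single j]
      · simp
      · intro b _ hb
        simp [hb]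
      · simp
    have h2 : T (Pi.single j y) = ∑ l, k l j • Pi.single l y := by
      ext l
      simp [T, Pi.single_apply, Finset.sum_apply]
    rw [← h1, ← hχ, LinearMap.comp_apply, h2, map_sum, LinearMap.sum_apply]
    refine Finset.sum_congr rfl fun l _ => ?_
    rw [map_smul]
    rfl
  have h3 : ∑ j, p (Pi.single j 1) ⊗ₜ[R] ψ j =
      ∑ l, p (k l) ⊗ₜ[R] (χ ∘ₗ LinearMap.single R (fun _ => J) l) := by
    simp_rw [hψ, tmul_sum]
    rw [Finset.sum_comm]
    refine Finset.sum_congr rfl fun l _ => ?_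
    conv_rhs => rw [pi_eq_sum_univ' (k l)]
    rw [map_sum, sum_tmul]
    refine Finset.sum_congr rfl fun j _ => ?_
    rw [map_smul, smul_tmul]
  rw [h3]
  refine Finset.sum_eq_zero fun l _ => ?_
  have h4 : k l ∈ LinearMap.ker p := hk ▸ Submodule.subset_span ⟨l, rfl⟩
  rw [LinearMap.mem_ker.1 h4, zero_tmul]

/-- Every map K → J extends to L, so evaluation on K ⊗ J^∨ is determined after passing to L ⊗ J^∨,
and the finitely generated case applies. This yields both flatness of J^∨ and injectivity of
evaluation for arbitrary L. -/
theorem eq_zero_of_rTensor_homEval [IsNoetherianRing R] (hE : Module.Injective R E)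
    (hJ : Module.Injective R J) [Module.Finite R K] (f : K →ₗ[R] L) (hf : Function.Injective f)
    (x : K ⊗[R] (J →ₗ[R] E)) (hx : homEval L J E (f.rTensor _ x) = 0) : x = 0 := by
  refine (injective_iff_map_eq_zero _).1 (homEval_injective_of_finite hE) x ?_
  ext φ
  obtain ⟨φ', rfl⟩ := Module.Injective.extension_property R J _ _ f hf φ
  rw [← homEval_rTensor, hx]
  rfl

theorem homEval_injective [IsNoetherianRing R] (hE : Module.Injective R E)
    (hJ : Module.Injective R J) : Function.Injective (homEval (R := R) L J E) := by
  refine (injective_iff_map_eq_zero _).2 fun x hx => ?_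
  obtain ⟨K, hK, h⟩ := TensorProduct.exists_finite_submodule_left_of_setFinite {x}
    (Set.finite_singleton x)
  obtain ⟨y, rfl⟩ := h rfl
  rw [eq_zero_of_rTensor_homEval hE hJ K.subtype K.injective_subtype y hx, map_zero]

/-- The dual of an injective module is flat. -/
theorem flat_dual [IsNoetherianRing R] (hE : Module.Injective R E) (hJ : Module.Injective R J) :
    Module.Flat R (J →ₗ[R] E) := by
  rw [Module.Flat.iff_rTensor_injective']
  intro I
  refine (injective_iff_map_eq_zero _).2 fun x hx => ?_
  exact eq_zero_of_rTensor_homEval hE hJ I.subtype I.injective_subtype x (by rw [hx, map_zero])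

end HomEval

/-! ### Homology of complexes of modules -/

section Homology

variable {R : Type u} [CommRing R]

theorem shortComplex_homologyπ_eq_zero (S : ShortComplex (ModuleCat.{u} R)) (z : S.cycles)
    (h : S.homologyπ.hom z = 0) : ∃ y, S.toCycles.hom y = z :=
  (ShortComplex.moduleCat_exact_iff _).1
    (ShortComplex.exact_of_g_is_cokernel (ShortComplex.mk S.toCycles S.homologyπ (by simp))
      S.homologyIsCokernel) z h

theorem shortComplex_exists_iCycles_eq (S : ShortComplex (ModuleCat.{u} R)) (x : S.X₂)
    (h : S.g.hom x = 0) : ∃ z, S.iCycles.hom z = x :=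
  (ShortComplex.moduleCat_exact_iff _).1
    (ShortComplex.exact_of_f_is_kernel (ShortComplex.mk S.iCycles S.g (by simp))
      S.cyclesIsKernel) x h

theorem shortComplex_iCycles_injective (S : ShortComplex (ModuleCat.{u} R)) :
    Function.Injective S.iCycles.hom :=
  (ModuleCat.mono_iff_injective _).1 inferInstance

theorem shortComplex_isIso_homologyMap {S S' : ShortComplex (ModuleCat.{u} R)} (φ : S ⟶ S')
    (hinj : ∀ x, S.g.hom x = 0 → ∀ y, φ.τ₂.hom x = S'.f.hom y → ∃ z, x = S.f.hom z)
    (hsurj : ∀ y, S'.g.hom y = 0 → ∃ x, S.g.hom x = 0 ∧ ∃ w, y = φ.τ₂.hom x + S'.f.hom w) :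
    IsIso (ShortComplex.homologyMap φ) := by
  have hπ : ∀ T : ShortComplex (ModuleCat.{u} R), Function.Surjective T.homologyπ.hom := fun T =>
    (ModuleCat.epi_iff_surjective _).1 inferInstance
  have hnat : ∀ z, (ShortComplex.homologyMap φ).hom (S.homologyπ.hom z) =
      S'.homologyπ.hom ((ShortComplex.cyclesMap φ).hom z) := fun z =>
    LinearMap.congr_fun (congrArg ModuleCat.Hom.hom (ShortComplex.homologyπ_naturality φ)) z
  have hi : ∀ z, S'.iCycles.hom ((ShortComplex.cyclesMap φ).hom z) =
      φ.τ₂.hom (S.iCycles.hom z) := fun z =>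
    LinearMap.congr_fun (congrArg ModuleCat.Hom.hom (ShortComplex.cyclesMap_i φ)) z
  have ht : ∀ (T : ShortComplex (ModuleCat.{u} R)) (y), T.iCycles.hom (T.toCycles.hom y) =
      T.f.hom y := fun T y =>
    LinearMap.congr_fun (congrArg ModuleCat.Hom.hom T.toCycles_i) y
  have hg : ∀ (T : ShortComplex (ModuleCat.{u} R)) (z), T.g.hom (T.iCycles.hom z) = 0 :=
    fun T z => LinearMap.congr_fun (congrArg ModuleCat.Hom.hom T.iCycles_g) z
  have h0 : ∀ (T : ShortComplex (ModuleCat.{u} R)) (y), T.homologyπ.hom (T.toCycles.hom y) = 0 :=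
    fun T y => LinearMap.congr_fun (congrArg ModuleCat.Hom.hom T.toCycles_comp_homologyπ) y
  have : Mono (ShortComplex.homologyMap φ) := by
    rw [ModuleCat.mono_iff_injective]
    refine (injective_iff_map_eq_zero (ShortComplex.homologyMap φ).hom).2 fun x hx => ?_
    obtain ⟨z, rfl⟩ := hπ S x
    rw [hnat] at hx
    obtain ⟨y, hy⟩ := shortComplex_homologyπ_eq_zero S' _ hx
    obtain ⟨w, hw⟩ := hinj _ (hg S z) y (by rw [← hi, ← hy, ht])
    rw [← ht] at hw
    rw [shortComplex_iCycles_injective S hw, h0]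
  have : Epi (ShortComplex.homologyMap φ) := by
    rw [ModuleCat.epi_iff_surjective]
    intro y
    obtain ⟨z, rfl⟩ := hπ S' y
    obtain ⟨x, hx, w, hw⟩ := hsurj _ (hg S' z)
    obtain ⟨x, rfl⟩ := shortComplex_exists_iCycles_eq S x hx
    refine ⟨S.homologyπ.hom x, ?_⟩
    have hz : z = (ShortComplex.cyclesMap φ).hom x + S'.toCycles.hom w := by
      apply shortComplex_iCycles_injective S'
      rw [hw, map_add, hi, ht]
    have := hnat x
    rw [hz, map_add, h0, add_zero]
    exact this
  exact isIso_of_mono_of_epi _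

/-- A criterion in terms of elements for a map of chain complexes of modules to induce an
isomorphism in homology. -/
theorem isIso_homologyMap {K K' : ChainComplex (ModuleCat.{u} R) ℕ} (φ : K ⟶ K') (i : ℕ)
    (hinj : ∀ x : K.X i, (∀ j, (K.d i j).hom x = 0) → ∀ y : K'.X (i + 1),
      (φ.f i).hom x = (K'.d (i + 1) i).hom y → ∃ z, x = (K.d (i + 1) i).hom z)
    (hsurj : ∀ y : K'.X i, (∀ j, (K'.d i j).hom y = 0) → ∃ x : K.X i,
      (∀ j, (K.d i j).hom x = 0) ∧ ∃ w, y = (φ.f i).hom x + (K'.d (i + 1) i).hom w) :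
    IsIso (HomologicalComplex.homologyMap φ i) := by
  have hp : (ComplexShape.down ℕ).prev i = i + 1 := ComplexShape.prev_eq' _ rfl
  have hcyc : ∀ (T : ChainComplex (ModuleCat.{u} R) ℕ) (x : T.X i),
      (T.sc i).g.hom x = 0 → ∀ j, (T.d i j).hom x = 0 := by
    intro T x hx j
    by_cases hj : (ComplexShape.down ℕ).Rel i j
    · obtain rfl : (ComplexShape.down ℕ).next i = j := ComplexShape.next_eq' _ hj
      exact hx
    · rw [T.shape i j hj]
      rfl
  apply shortComplex_isIso_homologyMap
  · intro x hx y hxy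
    change ∃ z : K.X ((ComplexShape.down ℕ).prev i), x = (K.d _ i).hom z
    change K'.X ((ComplexShape.down ℕ).prev i) at y
    change (φ.f i).hom x = (K'.d ((ComplexShape.down ℕ).prev i) i).hom y at hxy
    revert y hxy
    rw [hp]
    exact hinj x (hcyc K x hx)
  · intro y hy
    obtain ⟨x, hx, hw⟩ := hsurj y (hcyc K' y hy)
    refine ⟨x, hx _, ?_⟩
    change ∃ w : K'.X ((ComplexShape.down ℕ).prev i), y = (φ.f i).hom x + (K'.d _ i).hom w
    rw [hp]
    exact hw

end Homology

/-! ### Homology of dual complexes -/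

section Dual

variable {R : Type u} [CommRing R] {E : Type u} [AddCommGroup E] [Module R E]

/-- A functional that vanishes on all cocycles factors through the differential, by injectivity of
E, and is therefore a boundary. -/
theorem dualHomologyAux_injective (hE : Module.Injective R E)
    (C : CochainComplex (ModuleCat.{u} R) ℕ) (i : ℕ) :
    Function.Injective (dualHomologyAux E C i) := by
  refine (injective_iff_map_eq_zero _).2 fun x hx => ?_
  obtain ⟨⟨ψ, hψ⟩, rfl⟩ := Submodule.mkQ_surjective _ x
  refine (Submodule.Quotient.mk_eq_zero
    (LinearMap.range ((dualComplex E C).sc i).moduleCatToCycles)).2 ?_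
  have hz : ∀ z, (hz : (C.sc i).g.hom z = 0) → (show C.X i →ₗ[R] E from ψ) z = 0 := fun z hz =>
    LinearMap.congr_fun hx (Submodule.Quotient.mk ⟨z, hz⟩)
  have hn : (ComplexShape.down ℕ).prev i = (ComplexShape.up ℕ).next i := by
    rw [ComplexShape.prev_eq' (ComplexShape.down ℕ) (show (ComplexShape.down ℕ).Rel (i + 1) i
      from rfl), ComplexShape.next_eq' (ComplexShape.up ℕ) (show (ComplexShape.up ℕ).Rel i (i + 1)
      from rfl)]
  obtain ⟨χ, hχ⟩ := exists_comp_eq_of_exact hE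
    (LinearMap.ker (C.d i ((ComplexShape.down ℕ).prev i)).hom).subtype
    (C.d i ((ComplexShape.down ℕ).prev i)).hom (by rw [Submodule.range_subtype])
    (show C.X i →ₗ[R] E from ψ) (by
      ext ⟨z, hz'⟩
      refine hz z ?_
      rw [hn] at hz'
      exact hz')
  exact ⟨χ, Subtype.ext hχ⟩

/-- A functional on cohomology is pulled back to the cocycles and extended to the whole term; it
kills coboundaries, so the extension is a cycle. -/
theorem dualHomologyAux_surjective (hE : Module.Injective R E)
    (C : CochainComplex (ModuleCat.{u} R) ℕ) (i : ℕ) :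
    Function.Surjective (dualHomologyAux E C i) := by
  intro f
  obtain ⟨ψ, hψ⟩ := Module.Injective.extension_property R E _ _
    (LinearMap.ker (C.sc i).g.hom).subtype (Submodule.injective_subtype _)
    (f ∘ₗ Submodule.mkQ _)
  have hcyc : ((dualComplex E C).sc i).g.hom ψ = 0 := by
    change ψ ∘ₗ (C.d ((ComplexShape.down ℕ).next i) i).hom = 0
    generalize (ComplexShape.down ℕ).next i = j
    by_cases hj : (ComplexShape.up ℕ).Rel j i
    · obtain rfl : (ComplexShape.up ℕ).prev i = j := ComplexShape.prev_eq' _ hj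
      ext x
      have h1 := LinearMap.congr_fun hψ ((C.sc i).moduleCatToCycles x)
      have h2 : (LinearMap.range (C.sc i).moduleCatToCycles).mkQ
          ((C.sc i).moduleCatToCycles x) = 0 :=
        (Submodule.Quotient.mk_eq_zero _).2 ⟨x, rfl⟩
      exact h1.trans ((congrArg f h2).trans (map_zero f))
    · rw [C.shape j i hj]
      ext x
      exact map_zero ψ
  refine ⟨Submodule.Quotient.mk ⟨ψ, hcyc⟩, ?_⟩
  apply LinearMap.ext
  intro z
  obtain ⟨z, rfl⟩ := Submodule.mkQ_surjective _ z
  exact LinearMap.congr_fun hψ z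

theorem dualHomology_bijective (hE : Module.Injective R E)
    (C : CochainComplex (ModuleCat.{u} R) ℕ) (i : ℕ) :
    Function.Bijective (dualHomology E C i) := by
  have h1 : Function.Bijective (LinearMap.lcomp R E (C.sc i).moduleCatHomologyIso.hom.hom) :=
    (LinearEquiv.congrLeft E R (C.sc i).moduleCatHomologyIso.toLinearEquiv.symm).bijective
  have h2 : Function.Bijective (dualHomologyAux E C i) :=
    ⟨dualHomologyAux_injective hE C i, dualHomologyAux_surjective hE C i⟩
  have h3 := ((dualComplex E C).sc i).moduleCatHomologyIso.toLinearEquiv.bijective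
  exact h1.comp (h2.comp h3)

end Dual

/-! ### Tor through flat resolutions -/

section Tor

open MonoidalCategory

variable {R : Type u} [CommRing R]

/-- The functor `L ⊗ -` on chain complexes. -/
abbrev tensorComplex (L : ModuleCat.{u} R) :
    ChainComplex (ModuleCat.{u} R) ℕ ⥤ ChainComplex (ModuleCat.{u} R) ℕ :=
  ((tensoringLeft (ModuleCat.{u} R)).obj L).mapHomologicalComplex _

/-- The map `K ⊗ C → L ⊗ C` of complexes induced by a map `K → L`. -/
abbrev tensorComplexMap {K L : ModuleCat.{u} R} (f : K ⟶ L)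
    (C : ChainComplex (ModuleCat.{u} R) ℕ) :
    (tensorComplex K).obj C ⟶ (tensorComplex L).obj C :=
  (NatTrans.mapHomologicalComplex ((tensoringLeft (ModuleCat.{u} R)).map f) _).app C

/-- The sequence `S ⊗ C` of chain complexes. -/
def tensorShortComplex (S : ShortComplex (ModuleCat.{u} R))
    (C : ChainComplex (ModuleCat.{u} R) ℕ) : ShortComplex (ChainComplex (ModuleCat.{u} R) ℕ) :=
  ShortComplex.mk (tensorComplexMap S.f C) (tensorComplexMap S.g C) (by
    ext n : 1
    change (S.f ▷ C.X n) ≫ (S.g ▷ C.X n) = 0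
    rw [← comp_whiskerRight, S.zero]
    exact MonoidalPreadditive.zero_whiskerRight)

theorem tensorShortComplex_shortExact {S : ShortComplex (ModuleCat.{u} R)} (hS : S.ShortExact)
    {C : ChainComplex (ModuleCat.{u} R) ℕ} (hC : ∀ n, Module.Flat R (C.X n)) :
    (tensorShortComplex S C).ShortExact := by
  apply HomologicalComplex.shortExact_of_degreewise_shortExact
  intro n
  have := hC n
  have hex : Function.Exact S.f.hom S.g.hom :=
    (ShortComplex.ShortExact.moduleCat_exact_iff_function_exact S).1 hS.exact
  apply ModuleCat.shortComplex_shortExact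
  · exact rTensor_exact (C.X n) hex hS.moduleCat_surjective_g
  · exact Module.Flat.rTensor_preserves_injective_linearMap S.f.hom hS.moduleCat_injective_f
  · exact LinearMap.rTensor_surjective (C.X n) hS.moduleCat_surjective_g

/-- The map `S ⊗ C → S ⊗ D` induced by a map `C → D` of complexes. -/
def tensorShortComplexMap (S : ShortComplex (ModuleCat.{u} R))
    {C D : ChainComplex (ModuleCat.{u} R) ℕ} (φ : C ⟶ D) :
    tensorShortComplex S C ⟶ tensorShortComplex S D where
  τ₁ := (tensorComplex S.X₁).map φ
  τ₂ := (tensorComplex S.X₂).map φ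
  τ₃ := (tensorComplex S.X₃).map φ
  comm₁₂ := (NatTrans.mapHomologicalComplex
    ((tensoringLeft (ModuleCat.{u} R)).map S.f) _).naturality φ
  comm₂₃ := (NatTrans.mapHomologicalComplex
    ((tensoringLeft (ModuleCat.{u} R)).map S.g) _).naturality φ

theorem quasiIso_tensor_of_flat (F : ModuleCat.{u} R) [Module.Flat R F]
    {C D : ChainComplex (ModuleCat.{u} R) ℕ} (φ : C ⟶ D) [QuasiIso φ] :
    QuasiIso ((tensorComplex F).map φ) := by
  have : ((tensoringLeft (ModuleCat.{u} R)).obj F).PreservesHomology := by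
    have h1 : Limits.PreservesFiniteLimits (tensorLeft F) := inferInstance
    have h2 : Limits.PreservesFiniteColimits (tensorLeft F) := inferInstance
    have : Limits.PreservesFiniteLimits ((tensoringLeft (ModuleCat.{u} R)).obj F) := h1
    have : Limits.PreservesFiniteColimits ((tensoringLeft (ModuleCat.{u} R)).obj F) := h2
    infer_instance
  infer_instance

/-- A quasi-isomorphism of complexes of flat modules remains one after tensoring. -/
theorem isIso_homologyMap_tensor {C D : ChainComplex (ModuleCat.{u} R) ℕ} (φ : C ⟶ D)
    [QuasiIso φ] (hC : ∀ n, Module.Flat R (C.X n)) (hD : ∀ n, Module.Flat R (D.X n)) (i : ℕ)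
    (L : ModuleCat.{u} R) :
    IsIso (HomologicalComplex.homologyMap ((tensorComplex L).map φ) i) := by
  -- Dimension shifting along 0 → K → F → L → 0 with F free; flat terms keep the sequences short
  -- exact after tensoring, and F preserves quasi-isomorphisms.
  have pres : ∀ L : ModuleCat.{u} R, ∃ S : ShortComplex (ModuleCat.{u} R),
      S.ShortExact ∧ Module.Flat R S.X₂ ∧ S.X₃ = L := fun L =>
    ⟨_, LinearMap.shortExact_shortComplexKer (Finsupp.linearCombination_surjective R
      Function.surjective_id),
      inferInstanceAs (Module.Flat R (L →₀ R)), rfl⟩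
  induction i using Nat.strong_induction_on generalizing L with
  | _ i ih =>
    have ih' : ∀ j, (ComplexShape.down ℕ).Rel i j → ∀ L : ModuleCat.{u} R,
        IsIso (HomologicalComplex.homologyMap ((tensorComplex L).map φ) j) := fun j hij L =>
      ih j (by have : j + 1 = i := hij; omega) L
    -- Surjectivity in degree i is proved first for every L, because the five lemma for L needs it
    -- for the kernel K in the same degree.
    have hepi : ∀ L : ModuleCat.{u} R,
        Epi (HomologicalComplex.homologyMap ((tensorComplex L).map φ) i) := by
      intro L
      obtain ⟨S, hS, hF, rfl⟩ := pres L
      have hq := quasiIso_tensor_of_flat S.X₂ φ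
      refine HomologicalComplex.HomologySequence.epi_homologyMap_τ₃ (tensorShortComplexMap S φ)
        (tensorShortComplex_shortExact hS hC) (tensorShortComplex_shortExact hS hD) i ?_ ?_ ?_
      · exact inferInstanceAs (Epi (HomologicalComplex.homologyMap ((tensorComplex S.X₂).map φ) i))
      · intro j hij
        have := ih' j hij S.X₁
        exact inferInstanceAs (Epi (HomologicalComplex.homologyMap ((tensorComplex S.X₁).map φ) j))
      · intro j hij
        exact inferInstanceAs (Mono (HomologicalComplex.homologyMap ((tensorComplex S.X₂).map φ) j))
    obtain ⟨S, hS, hF, rfl⟩ := pres L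
    have hq := quasiIso_tensor_of_flat S.X₂ φ
    refine HomologicalComplex.HomologySequence.isIso_homologyMap_τ₃ (tensorShortComplexMap S φ)
      (tensorShortComplex_shortExact hS hC) (tensorShortComplex_shortExact hS hD) i ?_ ?_ ?_ ?_
    · exact hepi S.X₁
    · exact inferInstanceAs (IsIso (HomologicalComplex.homologyMap ((tensorComplex S.X₂).map φ) i))
    · intro j hij
      exact ih' j hij S.X₁
    · intro j hij
      exact inferInstanceAs (Mono (HomologicalComplex.homologyMap ((tensorComplex S.X₂).map φ) j))

variable {E : Type u} [AddCommGroup E] [Module R E]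

theorem injectiveResolution_injective {L' : ModuleCat.{u} R} (J : InjectiveResolution L')
    (n : ℕ) : Module.Injective R (J.cocomplex.X n) :=
  Module.injective_module_of_injective_object R (J.cocomplex.X n)
    (inj := J.injective n)

theorem dualComplex_exact_succ (hE : Module.Injective R E) {L' : ModuleCat.{u} R}
    (J : InjectiveResolution L') (n : ℕ) (ψ : (dualComplex E J.cocomplex).X (n + 1))
    (hψ : ((dualComplex E J.cocomplex).d (n + 1) n).hom ψ = 0) :
    ∃ χ, ((dualComplex E J.cocomplex).d (n + 2) (n + 1)).hom χ = ψ :=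
  exists_comp_eq_of_exact hE (J.cocomplex.d n (n + 1)).hom (J.cocomplex.d (n + 1) (n + 2)).hom
    ((ShortComplex.moduleCat_exact_iff_ker_sub_range _).1 (J.exact_succ n)) ψ hψ

theorem dualComplex_exact_zero (hE : Module.Injective R E) {L' : ModuleCat.{u} R}
    (J : InjectiveResolution L') (ψ : (dualComplex E J.cocomplex).X 0)
    (hψ : (dualAug E J).hom ψ = 0) : ∃ χ, ((dualComplex E J.cocomplex).d 1 0).hom χ = ψ :=
  exists_comp_eq_of_exact hE (coaug J).hom (J.cocomplex.d 0 1).hom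
    ((ShortComplex.moduleCat_exact_iff_ker_sub_range _).1 J.exact₀) ψ hψ

theorem d_comp_dualAug {L' : ModuleCat.{u} R} (J : InjectiveResolution L')
    (χ : (dualComplex E J.cocomplex).X 1) :
    (dualAug E J).hom (((dualComplex E J.cocomplex).d 1 0).hom χ) = 0 := by
  ext x
  have h : (J.cocomplex.d 0 1).hom ((coaug J).hom x) = 0 :=
    LinearMap.congr_fun (congrArg ModuleCat.Hom.hom J.ι_f_zero_comp_complex_d) x
  change (show J.cocomplex.X 1 →ₗ[R] E from χ) ((J.cocomplex.d 0 1).hom ((coaug J).hom x)) = 0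
  rw [h, map_zero]

/-- Both complexes resolve M'^∨ for M' = L', and the lift respects the augmentations. In positive
degrees both homologies vanish. -/
theorem quasiIso_liftDual (hE : Module.Injective R E) {L' : ModuleCat.{u} R}
    (J : InjectiveResolution L') (P : ProjectiveResolution (dualObj E L')) :
    QuasiIso (liftDual hE J P) := by
  rw [quasiIso_iff]
  intro i
  rw [quasiIsoAt_iff_isIso_homologyMap]
  have hlift : ∀ x, (dualAug E J).hom (((liftDual hE J P).f 0).hom x) = (aug P).hom x := fun x =>
    LinearMap.congr_fun (congrArg ModuleCat.Hom.hom (liftDual_comp hE J P)) x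
  rcases i with _ | i
  · apply isIso_homologyMap
    · intro x _ y hxy
      have h1 : (aug P).hom x = 0 := by
        rw [← hlift, hxy, d_comp_dualAug]
      obtain ⟨z, hz⟩ := (ShortComplex.moduleCat_exact_iff _).1 P.exact₀ x h1
      exact ⟨z, hz.symm⟩
    · intro y _
      have hs : Function.Surjective (aug P).hom :=
        (ModuleCat.epi_iff_surjective _).1 (inferInstanceAs (Epi (P.π.f 0)))
      obtain ⟨x, hx⟩ := hs ((dualAug E J).hom y)
      obtain ⟨w, hw⟩ := dualComplex_exact_zero hE J (y - ((liftDual hE J P).f 0).hom x) (by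
        rw [map_sub, hlift, hx, sub_self])
      refine ⟨x, fun j => ?_, w, ?_⟩
      · rw [P.complex.shape 0 j (by simp)]
        rfl
      · rw [hw, add_sub_cancel]
  · apply isIso_homologyMap
    · intro x hx _ _
      obtain ⟨z, hz⟩ := (ShortComplex.moduleCat_exact_iff _).1 (P.exact_succ i) x (hx i)
      exact ⟨z, hz.symm⟩
    · intro y hy
      obtain ⟨w, hw⟩ := dualComplex_exact_succ hE J i y (hy i)
      exact ⟨0, fun j => map_zero _, w, by rw [hw, map_zero, zero_add]⟩

theorem isIso_torToHomology [IsNoetherianRing R] (hE : Module.Injective R E)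
    (L : ModuleCat.{u} R) {L' : ModuleCat.{u} R} (J : InjectiveResolution L') (i : ℕ) :
    IsIso (torToHomology hE L J i) := by
  have := quasiIso_liftDual hE J (projectiveResolution (dualObj E L'))
  have := isIso_homologyMap_tensor (liftDual hE J (projectiveResolution (dualObj E L')))
    (fun n => by
      have : Module.Projective R ((projectiveResolution (dualObj E L')).complex.X n) :=
        (IsProjective.iff_projective _).2
          ((projectiveResolution (dualObj E L')).projective n)
      infer_instance)
    (fun n => flat_dual hE (injectiveResolution_injective J n)) i L
  exact @IsIso.comp_isIso _ _ _ _ _ _ _ (Iso.isIso_hom _) this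

end Tor

/-! ### The evaluation morphism of complexes -/

section Evaluation

open TensorProduct

variable {R : Type u} [CommRing R] {E : Type u} [AddCommGroup E] [Module R E]

/-- The cokernel of `L ⊗ Hom(C, E) → Hom(Hom(L, C), E)` is exact in degree `i`. -/
def IsEvalExactAt (E : Type u) [AddCommGroup E] [Module R E] (L : Type u) [AddCommGroup L]
    [Module R L] (C : CochainComplex (ModuleCat.{u} R) ℕ) (i : ℕ) : Prop :=
  ∀ y : (L →ₗ[R] C.X i) →ₗ[R] E,
    (∀ j, ∃ b : L ⊗[R] (C.X j →ₗ[R] E), ∀ φ : L →ₗ[R] C.X j,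
      y ((C.d j i).hom ∘ₗ φ) = homEval L (C.X j) E b φ) →
    ∃ (b : L ⊗[R] (C.X i →ₗ[R] E)) (w : (L →ₗ[R] C.X (i + 1)) →ₗ[R] E), ∀ φ : L →ₗ[R] C.X i,
      y φ = homEval L (C.X i) E b φ + w ((C.d i (i + 1)).hom ∘ₗ φ)

theorem homEval_lTensor {L J J' : Type u} [AddCommGroup L] [Module R L] [AddCommGroup J]
    [Module R J] [AddCommGroup J'] [Module R J'] (f : J →ₗ[R] J') (b : L ⊗[R] (J' →ₗ[R] E))
    (φ : L →ₗ[R] J) :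
    homEval L J E ((LinearMap.lcomp R E f).lTensor L b) φ = homEval L J' E b (f ∘ₗ φ) := by
  induction b using TensorProduct.induction_on with
  | zero => simp
  | add x y hx hy => rw [map_add, map_add, LinearMap.add_apply, hx, hy, map_add]; rfl
  | tmul k ψ => rfl

/-- Evaluation is injective in each degree, so this is the long exact sequence with an acyclic
cokernel, written with elements: exactness in degree i + 1 gives injectivity, exactness in degree i
surjectivity. -/
theorem isIso_homologyMap_homEvalComplex [IsNoetherianRing R] (hE : Module.Injective R E)
    (L : ModuleCat.{u} R) (C : CochainComplex (ModuleCat.{u} R) ℕ)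
    (hC : ∀ n, Module.Injective R (C.X n)) (hL : ∀ n, IsEvalExactAt E L C n) (i : ℕ) :
    IsIso (HomologicalComplex.homologyMap (homEvalComplex E L C) i) := by
  have hinj : ∀ n, Function.Injective (homEval (R := R) L (C.X n) E) := fun n =>
    homEval_injective hE (hC n)
  apply isIso_homologyMap
  · intro x hx y hxy
    change L ⊗[R] (C.X i →ₗ[R] E) at x
    change (L →ₗ[R] C.X (i + 1)) →ₗ[R] E at y
    change homEval L (C.X i) E x = LinearMap.lcomp R E _ y at hxy
    -- The functional y is a cycle of the cokernel because its boundary is the evaluation of x; only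
    -- j = i carries a nonzero differential.
    obtain ⟨b, w, h⟩ := hL (i + 1) y (fun j => by
      by_cases hj : j = i
      · subst hj
        exact ⟨x, fun φ => (LinearMap.congr_fun hxy φ).symm⟩
      · refine ⟨0, fun φ => ?_⟩
        rw [C.shape j (i + 1) (by simpa using fun h => hj h)]
        have : (0 : C.X j ⟶ C.X (i + 1)).hom ∘ₗ φ = 0 := rfl
        rw [this, map_zero, map_zero, LinearMap.zero_apply])
    refine ⟨b, ?_⟩
    apply hinj i
    apply LinearMap.ext
    intro φ
    rw [LinearMap.congr_fun hxy φ]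
    refine (h ((C.d i (i + 1)).hom ∘ₗ φ)).trans ?_
    have h0 : (C.d (i + 1) (i + 1 + 1)).hom ∘ₗ (C.d i (i + 1)).hom ∘ₗ φ = 0 := by
      rw [← LinearMap.comp_assoc, ← ModuleCat.hom_comp, C.d_comp_d]
      rfl
    rw [h0, map_zero, add_zero]
    exact (homEval_lTensor (C.d i (i + 1)).hom b φ).symm
  · intro y hy
    change (L →ₗ[R] C.X i) →ₗ[R] E at y
    obtain ⟨b, w, h⟩ := hL i y (fun j => ⟨0, fun φ => by
      rw [map_zero]
      exact LinearMap.congr_fun (hy j) φ⟩)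
    refine ⟨b, fun j => ?_, w, LinearMap.ext h⟩
    apply hinj j
    refine Eq.trans ?_ (map_zero (homEval (R := R) L (C.X j) E)).symm
    apply LinearMap.ext
    intro φ
    refine (homEval_lTensor (C.d j i).hom b φ).trans ?_
    have h1 := h ((C.d j i).hom ∘ₗ φ)
    have h0 : (C.d i (i + 1)).hom ∘ₗ (C.d j i).hom ∘ₗ φ = 0 := by
      rw [← LinearMap.comp_assoc, ← ModuleCat.hom_comp, C.d_comp_d]
      rfl
    rw [h0, map_zero, add_zero] at h1
    rw [← h1]
    exact LinearMap.congr_fun (hy j) φ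

/-- Restricting y to maps that factor through M/N reduces it to an evaluation plus a boundary, and
both lift to M. The remainder kills Hom(M/N, C), hence depends only on restrictions to N, where
every functional is an evaluation. -/
theorem IsEvalExactAt.of_quotient (hE : Module.Injective R E) {M : Type u} [AddCommGroup M]
    [Module R M] (N : Submodule R M) [Module.Finite R N]
    (C : CochainComplex (ModuleCat.{u} R) ℕ) (i : ℕ) (h : IsEvalExactAt E (M ⧸ N) C i) :
    IsEvalExactAt E M C i := by
  intro y hy
  obtain ⟨b', w', hbw⟩ := h (y ∘ₗ LinearMap.lcomp R (C.X i) N.mkQ) (fun j => by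
    obtain ⟨b, hb⟩ := hy j
    refine ⟨N.mkQ.rTensor _ b, fun φ => ?_⟩
    rw [homEval_rTensor]
    exact hb (φ ∘ₗ N.mkQ))
  obtain ⟨b, rfl⟩ := LinearMap.rTensor_surjective _ N.mkQ_surjective b'
  obtain ⟨w, rfl⟩ := Module.Injective.extension_property R E _ _
    (LinearMap.lcomp R (C.X (i + 1)) N.mkQ)
    (fun φ φ' hφ => (LinearMap.cancel_right N.mkQ_surjective).1 hφ) w'
  let y' : (M →ₗ[R] C.X i) →ₗ[R] E := y - homEval M (C.X i) E b -
    w ∘ₗ LinearMap.compRight R (M := M) (C.d i (i + 1)).hom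
  obtain ⟨z, hz⟩ := exists_comp_eq_of_exact hE (LinearMap.lcomp R (C.X i) N.mkQ)
    (LinearMap.lcomp R (C.X i) N.subtype) (fun φ hφ => by
      have hle : N ≤ LinearMap.ker φ := fun n hn =>
        LinearMap.congr_fun (LinearMap.mem_ker.1 hφ) ⟨n, hn⟩
      exact ⟨N.liftQ φ hle, N.liftQ_mkQ φ hle⟩) y' (by
      ext φ
      have h1 := hbw φ
      rw [homEval_rTensor] at h1
      change y (φ ∘ₗ N.mkQ) - homEval M (C.X i) E b (φ ∘ₗ N.mkQ) -
        w ((C.d i (i + 1)).hom ∘ₗ φ ∘ₗ N.mkQ) = 0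
      change y (φ ∘ₗ N.mkQ) = homEval M (C.X i) E b (φ ∘ₗ N.mkQ) +
        w ((C.d i (i + 1)).hom ∘ₗ φ ∘ₗ N.mkQ) at h1
      rw [h1]
      abel)
  obtain ⟨n, rfl⟩ := homEval_surjective_of_finite hE z
  refine ⟨b + N.subtype.rTensor _ n, w, fun φ => ?_⟩
  have h2 := LinearMap.congr_fun hz φ
  change homEval N (C.X i) E n (φ ∘ₗ N.subtype) = y φ - homEval M (C.X i) E b φ -
    w ((C.d i (i + 1)).hom ∘ₗ φ) at h2
  rw [map_add, LinearMap.add_apply, homEval_rTensor, h2]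
  abel

end Evaluation

/-! ### The evaluation morphism for artinian modules -/

section ArtinianEvaluation

open IsLocalRing TensorProduct

variable {R : Type u} [CommRing R] {E : Type u} [AddCommGroup E] [Module R E]

theorem torsionSMul_add {a : Ideal R} {V : Type*} [AddCommGroup V] [Module R V]
    (hV : IsPowTorsion a V) (s : AdicCompletion a R) (v w : V) :
    torsionSMul hV s (v + w) = torsionSMul hV s v + torsionSMul hV s w :=
  map_add (torsionEnd hV s) v w

theorem add_torsionSMul {a : Ideal R} {V : Type*} [AddCommGroup V] [Module R V]
    (hV : IsPowTorsion a V) (s t : AdicCompletion a R) (v : V) :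
    torsionSMul hV (s + t) v = torsionSMul hV s v + torsionSMul hV t v :=
  (torsionModule hV).add_smul s t v

theorem mul_torsionSMul {a : Ideal R} {V : Type*} [AddCommGroup V] [Module R V]
    (hV : IsPowTorsion a V) (s t : AdicCompletion a R) (v : V) :
    torsionSMul hV (s * t) v = torsionSMul hV s (torsionSMul hV t v) :=
  (torsionModule hV).mul_smul s t v

variable {A J : Type u} [AddCommGroup A] [Module R A] [AddCommGroup J] [Module R J]

/-- J need not be torsion: an elementary tensor evaluates through composites A → J → E, which are
maps of torsion modules and hence R^-linear. -/
theorem homEval_comp_torsionEnd {a : Ideal R} (hA : IsPowTorsion a A) (hE : IsPowTorsion a E)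
    (b : A ⊗[R] (J →ₗ[R] E)) (φ : A →ₗ[R] J) (s : AdicCompletion a R) :
    homEval A J E b (φ ∘ₗ torsionEnd hA s) = torsionSMul hE s (homEval A J E b φ) := by
  induction b using TensorProduct.induction_on with
  | zero =>
    rw [map_zero, LinearMap.zero_apply, LinearMap.zero_apply]
    exact (map_zero (torsionEnd hE s)).symm
  | add x y hx hy =>
    rw [map_add, LinearMap.add_apply, LinearMap.add_apply, hx, hy, torsionSMul_add]
  | tmul k ψ => exact map_torsionSMul hA hE (ψ ∘ₗ φ) s k

/-- Write s = t + r with r in R and t in IR^. The part r is covered by R-linearity of y; in t the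
factors from I can be moved onto φ, where linearity is assumed. -/
theorem map_comp_torsionEnd_of_isSurjectiveModulo {a : Ideal R} (hA : IsPowTorsion a A)
    (hE : IsPowTorsion a E) {I : Ideal R} (hI : IsSurjectiveModulo a I)
    (y : (A →ₗ[R] J) →ₗ[R] E) (φ : A →ₗ[R] J)
    (hφ : ∀ x ∈ I, ∀ s, y ((x • φ) ∘ₗ torsionEnd hA s) = torsionSMul hE s (y (x • φ)))
    (s : AdicCompletion a R) :
    y (φ ∘ₗ torsionEnd hA s) = torsionSMul hE s (y φ) := by
  -- The additional factor s lets the induction over the span pass through scalar multiplication by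
  -- R^.
  have key : ∀ t ∈ I.map (algebraMap R (AdicCompletion a R)), ∀ s,
      y (φ ∘ₗ torsionEnd hA (s * t)) = torsionSMul hE (s * t) (y φ) := by
    intro t ht
    induction ht using Submodule.span_induction with
    | mem x hx =>
      obtain ⟨x, hx, rfl⟩ := hx
      intro s
      have h1 : φ ∘ₗ torsionEnd hA (s * algebraMap R _ x) = (x • φ) ∘ₗ torsionEnd hA s := by
        ext v
        simp [mul_comm s, mul_torsionSMul, torsionSMul_algebraMap]
      rw [h1, hφ x hx, mul_torsionSMul, torsionSMul_algebraMap, map_smul]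
    | zero =>
      intro s
      have h1 : φ ∘ₗ torsionEnd hA (s * 0) = 0 := by
        ext v
        simp only [mul_zero, LinearMap.comp_apply, torsionEnd_apply, LinearMap.zero_apply]
        exact (congrArg φ ((torsionModule hA).zero_smul v)).trans (map_zero φ)
      rw [h1, map_zero, mul_zero]
      exact ((torsionModule hE).zero_smul _).symm
    | add t t' _ _ ht ht' =>
      intro s
      have h1 : φ ∘ₗ torsionEnd hA (s * (t + t')) =
          φ ∘ₗ torsionEnd hA (s * t) + φ ∘ₗ torsionEnd hA (s * t') := by
        ext v
        simp [mul_add, add_torsionSMul]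
      rw [h1, map_add, ht, ht', mul_add, add_torsionSMul]
    | smul s' t _ ht =>
      intro s
      rw [smul_eq_mul, ← mul_assoc]
      exact ht (s * s')
  obtain ⟨r, hr⟩ := hI s
  have h1 := key _ hr 1
  rw [one_mul] at h1
  obtain ⟨t, rfl⟩ : ∃ t, s = t + algebraMap R _ r := ⟨s - algebraMap R _ r, by ring⟩
  rw [add_sub_cancel_right] at h1
  have h2 : φ ∘ₗ torsionEnd hA (t + algebraMap R _ r) = φ ∘ₗ torsionEnd hA t + r • φ := by
    ext v
    simp [add_torsionSMul, torsionSMul_algebraMap]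
  rw [h2, map_add, h1, map_smul, add_torsionSMul, torsionSMul_algebraMap]

variable [IsLocalRing R] {ι : ResidueField R →ₗ[R] E}

/-- There is a map from `J` to a finite power of `E` that is injective on the socle. -/
def HasFiniteSocle (E J : Type u) [AddCommGroup E] [Module R E] [AddCommGroup J] [Module R J] :
    Prop :=
  ∃ (μ : ℕ) (ψ : J →ₗ[R] (Fin μ → E)), ∀ y : J,
    (∀ x ∈ maximalIdeal R, x • y = 0) → ψ y = 0 → y = 0

theorem exists_smul_mem_socle {n : ℕ} {v : J} (hn : ∀ x ∈ maximalIdeal R ^ n, x • v = 0)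
    (hv : v ≠ 0) : ∃ r : R, r • v ≠ 0 ∧ ∀ x ∈ maximalIdeal R, x • r • v = 0 := by
  induction n generalizing v with
  | zero => exact absurd (by simpa using hn 1 (by simp)) hv
  | succ n ih =>
    by_cases h : ∀ x ∈ maximalIdeal R ^ n, x • v = 0
    · exact ih h hv
    · push Not at h
      obtain ⟨x, hx, hxv⟩ := h
      refine ⟨x, hxv, fun y hy => ?_⟩
      rw [← mul_smul]
      exact hn _ (by rw [pow_succ']; exact Ideal.mul_mem_mul hy hx)

variable [IsNoetherianRing R]

/-- Otherwise a functional χ on E^F kills the image of T but not the tuple of values of g. Since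
End(E) is given by R^, χ is a tuple of scalars s_φ; vanishing on the image means ∑ ψ ∘ φ ∘ s_φ = 0,
so ∑ φ ∘ s_φ = 0. Applying g, which commutes with these scalars, shows that χ kills the tuple after
all. -/
theorem IsInjectiveHull.exists_sum_eq_finset (hι : IsInjectiveHull ι)
    (hA : IsPowTorsion (maximalIdeal R) A) {μ : ℕ} (ψ : J →ₗ[R] (Fin μ → E))
    (hψ : ∀ φ : A →ₗ[R] J, ψ ∘ₗ φ = 0 → φ = 0) (g : (A →ₗ[R] J) →ₗ[R] E)
    (F : Finset (A →ₗ[R] J))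
    (hg : ∀ φ ∈ F, ∀ s, g (φ ∘ₗ torsionEnd hA s) = torsionSMul hι.isPowTorsion s (g φ)) :
    ∃ v : Fin μ → A, ∀ φ ∈ F, g φ = ∑ j, ψ (φ (v j)) j := by
  let T : (Fin μ → A) →ₗ[R] (F → E) :=
    LinearMap.pi fun φ => ∑ j, LinearMap.proj j ∘ₗ ψ ∘ₗ φ.1 ∘ₗ LinearMap.proj j
  have hT : ∀ v φ, T v φ = ∑ j, ψ (φ.1 (v j)) j := fun v φ => by simp [T]
  suffices h : (fun φ : F => g φ.1) ∈ LinearMap.range T by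
    obtain ⟨v, hv⟩ := h
    exact ⟨v, fun φ hφ => by rw [← hT v ⟨φ, hφ⟩, hv]⟩
  classical
  by_contra hcon
  obtain ⟨χ, hχ, hne⟩ := hι.exists_apply_ne_zero_of_notMem _ hcon
  choose s hs using fun φ : F =>
    hι.exists_torsionSMul_eq (χ ∘ₗ LinearMap.single R (fun _ => E) φ)
  have hsum : ∀ e : F → E, χ e = ∑ φ, torsionSMul hι.isPowTorsion (s φ) (e φ) := fun e => by
    conv_lhs => rw [← Finset.univ_sum_single e, map_sum]
    exact Finset.sum_congr rfl fun φ _ => hs φ (e φ)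
  have hΦ : ∑ φ : F, φ.1 ∘ₗ torsionEnd hA (s φ) = 0 := by
    apply hψ
    ext x j
    have h1 := hχ _ ⟨Pi.single j x, rfl⟩
    rw [hsum] at h1
    rw [LinearMap.comp_apply, LinearMap.sum_apply, map_sum, Finset.sum_apply]
    refine Eq.trans (Finset.sum_congr rfl fun φ _ => ?_) h1
    have h2 : T (Pi.single j x) φ = ψ (φ.1 x) j := by
      rw [hT, Finset.sum_eq_single j]
      · rw [Pi.single_eq_same]
      · intro k _ hk
        rw [Pi.single_eq_of_ne hk, map_zero, map_zero, Pi.zero_apply]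
      · simp
    rw [h2]
    exact map_torsionSMul hA hι.isPowTorsion (LinearMap.proj j ∘ₗ ψ ∘ₗ φ.1) (s φ) x
  apply hne
  rw [hsum]
  have h3 := congrArg g hΦ
  rw [map_sum, map_zero] at h3
  rw [← h3]
  exact Finset.sum_congr rfl fun φ _ => (hg φ.1 φ.2 (s φ)).symm

/-- Functionals on a set of maps from an artinian module that are linear over the completion are
given by evaluation. -/
theorem IsInjectiveHull.exists_sum_eq (hι : IsInjectiveHull ι) [IsArtinian R A]
    (hA : IsPowTorsion (maximalIdeal R) A) {μ : ℕ} (ψ : J →ₗ[R] (Fin μ → E))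
    (hψ : ∀ φ : A →ₗ[R] J, ψ ∘ₗ φ = 0 → φ = 0) (g : (A →ₗ[R] J) →ₗ[R] E)
    (Z : Set (A →ₗ[R] J))
    (hg : ∀ φ ∈ Z, ∀ s, g (φ ∘ₗ torsionEnd hA s) = torsionSMul hι.isPowTorsion s (g φ)) :
    ∃ v : Fin μ → A, ∀ φ ∈ Z, g φ = ∑ j, ψ (φ (v j)) j := by
  classical
  let ev : (A →ₗ[R] J) → (Fin μ → A) →ₗ[R] E := fun φ =>
    ∑ j, LinearMap.proj j ∘ₗ ψ ∘ₗ φ ∘ₗ LinearMap.proj j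
  have hev : ∀ φ v, ev φ v = ∑ j, ψ (φ (v j)) j := fun φ v => by simp [ev]
  let N : Finset (A →ₗ[R] J) → Submodule R (Fin μ → A) := fun F =>
    F.inf fun φ => LinearMap.ker (ev φ)
  -- Since A^μ is artinian, some finite F has the smallest common kernel. Adding one more φ from Z
  -- does not shrink it, so a solution for F already works for φ.
  obtain ⟨_, ⟨F, hF, rfl⟩, hmin⟩ := IsArtinian.set_has_minimal (R := R) (M := Fin μ → A)
    (N '' {F | (F : Set (A →ₗ[R] J)) ⊆ Z}) ⟨_, ∅, by simp, rfl⟩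
  obtain ⟨v, hv⟩ := hι.exists_sum_eq_finset hA ψ hψ g F fun φ hφ => hg φ (hF hφ)
  refine ⟨v, fun φ hφ => ?_⟩
  have hF' : ((insert φ F : Finset (A →ₗ[R] J)) : Set (A →ₗ[R] J)) ⊆ Z := by
    rw [Finset.coe_insert]
    exact Set.insert_subset hφ hF
  obtain ⟨v', hv'⟩ := hι.exists_sum_eq_finset hA ψ hψ g (insert φ F) fun φ hφ => hg φ (hF' hφ)
  have hle : N (insert φ F) ≤ N F := Finset.inf_mono (Finset.subset_insert _ _)
  have heq : N (insert φ F) = N F := by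
    by_contra hne
    exact hmin _ ⟨_, hF', rfl⟩ (lt_of_le_of_ne hle hne)
  have hmem : v' - v ∈ N F := by
    simp only [N, Submodule.mem_finsetInf]
    intro χ hχ
    rw [LinearMap.mem_ker, map_sub, hev, hev, ← hv χ hχ,
      ← hv' χ (Finset.mem_insert_of_mem hχ), sub_self]
  rw [← heq] at hmem
  have h1 := (Submodule.mem_finsetInf.1 hmem) φ (Finset.mem_insert_self _ _)
  rw [LinearMap.mem_ker, map_sub, sub_eq_zero, hev, hev] at h1
  rw [← h1]
  exact hv' φ (Finset.mem_insert_self _ _)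

theorem IsEvalExactAt.of_isArtinian (hι : IsInjectiveHull ι) [IsArtinian R A]
    (C : CochainComplex (ModuleCat.{u} R) ℕ) (hC : ∀ n, HasFiniteSocle (R := R) E (C.X n))
    {I : Ideal R} (hI : IsSurjectiveModulo (maximalIdeal R) I) (i : ℕ)
    (hann : ∀ x ∈ I, ∀ φ : A →ₗ[R] C.X i, (C.d i (i + 1)).hom ∘ₗ φ = 0 →
      ∃ (j : ℕ) (φ' : A →ₗ[R] C.X j), (C.d j i).hom ∘ₗ φ' = x • φ) :
    IsEvalExactAt E A C i := by
  have hA := hι.isPowTorsion_of_isArtinian A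
  obtain ⟨μ, ψ, hψ⟩ := hC i
  -- Values of φ are torsion, so a nonzero value has a nonzero multiple in the socle, where ψ is
  -- injective.
  have hψ' : ∀ φ : A →ₗ[R] C.X i, ψ ∘ₗ φ = 0 → φ = 0 := by
    intro φ hφ
    ext x
    by_contra hne
    obtain ⟨n, hn⟩ := hA x
    obtain ⟨r, hr, hr'⟩ := exists_smul_mem_socle (n := n) (v := φ x)
      (fun y hy => by rw [← map_smul, hn y hy, map_zero]) hne
    refine hr (hψ _ hr' ?_)
    rw [← map_smul]
    exact LinearMap.congr_fun hφ (r • x)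
  intro y hy
  have hB : ∀ (j : ℕ) (φ : A →ₗ[R] C.X j) (s), y ((C.d j i).hom ∘ₗ φ ∘ₗ torsionEnd hA s) =
      torsionSMul hι.isPowTorsion s (y ((C.d j i).hom ∘ₗ φ)) := by
    intro j φ s
    obtain ⟨b, hb⟩ := hy j
    rw [hb, hb, homEval_comp_torsionEnd hA hι.isPowTorsion]
  -- Elements of I turn a cocycle into a coboundary, where y is an evaluation and thus R^-linear.
  have hlin : ∀ φ : A →ₗ[R] C.X i, (C.d i (i + 1)).hom ∘ₗ φ = 0 → ∀ s,
      y (φ ∘ₗ torsionEnd hA s) = torsionSMul hι.isPowTorsion s (y φ) := by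
    intro φ hφ
    refine map_comp_torsionEnd_of_isSurjectiveModulo hA hι.isPowTorsion hI y φ
      fun x hx s => ?_
    obtain ⟨j, φ', hφ'⟩ := hann x hx φ hφ
    rw [← hφ', LinearMap.comp_assoc]
    exact hB j φ' s
  obtain ⟨v, hv⟩ := hι.exists_sum_eq hA ψ hψ' y {φ | (C.d i (i + 1)).hom ∘ₗ φ = 0} hlin
  let b : A ⊗[R] (C.X i →ₗ[R] E) := ∑ j, v j ⊗ₜ (LinearMap.proj j ∘ₗ ψ)
  have hb : ∀ φ, homEval A (C.X i) E b φ = ∑ j, ψ (φ (v j)) j := fun φ => by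
    rw [map_sum, LinearMap.sum_apply]
    rfl
  let D : (A →ₗ[R] C.X i) →ₗ[R] (A →ₗ[R] C.X (i + 1)) :=
    LinearMap.compRight R (M := A) (C.d i (i + 1)).hom
  -- The functional y minus the evaluation vanishes on cocycles, hence factors through the
  -- differential.
  obtain ⟨w, hw⟩ := exists_comp_eq_of_exact hι.injective_module (LinearMap.ker D).subtype D
    (by rw [Submodule.range_subtype]) (y - homEval A (C.X i) E b) (by
      ext ⟨φ, hφ⟩
      change y φ - homEval A (C.X i) E b φ = 0
      rw [hb, sub_eq_zero]
      exact hv φ hφ)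
  refine ⟨b, w, fun φ => ?_⟩
  have := LinearMap.congr_fun hw φ
  change w ((C.d i (i + 1)).hom ∘ₗ φ) = y φ - homEval A (C.X i) E b φ at this
  rw [this, add_sub_cancel]

end ArtinianEvaluation

/-! ### Torsion in injective modules -/

section PowTorsion

variable {R : Type u} [CommRing R]

/-- The submodule of elements annihilated by a power of `a`. -/
def powTorsion (a : Ideal R) (Q : Type u) [AddCommGroup Q] [Module R Q] : Submodule R Q where
  carrier := {q | ∃ n : ℕ, ∀ x ∈ a ^ n, x • q = 0}
  zero_mem' := ⟨0, fun x _ => smul_zero x⟩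
  add_mem' := by
    rintro p q ⟨m, hm⟩ ⟨n, hn⟩
    refine ⟨max m n, fun x hx => ?_⟩
    rw [smul_add, hm x (Ideal.pow_le_pow_right (le_max_left m n) hx),
      hn x (Ideal.pow_le_pow_right (le_max_right m n) hx), add_zero]
  smul_mem' := by
    rintro r q ⟨n, hn⟩
    exact ⟨n, fun x hx => by rw [smul_comm, hn x hx, smul_zero]⟩

variable {a : Ideal R} {Q : Type u} [AddCommGroup Q] [Module R Q]

theorem exists_pow_smul_eq_zero_of_fg {N : Submodule R Q} (hN : N.FG)
    (h : N ≤ powTorsion a Q) : ∃ n : ℕ, ∀ x ∈ a ^ n, ∀ q ∈ N, x • q = 0 := by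
  induction N, hN using Submodule.fg_induction with
  | singleton q =>
    obtain ⟨n, hn⟩ := h (Submodule.mem_span_singleton_self q)
    refine ⟨n, fun x hx p hp => ?_⟩
    obtain ⟨r, rfl⟩ := Submodule.mem_span_singleton.1 hp
    rw [smul_comm, hn x hx, smul_zero]
  | sup N₁ N₂ _ _ ih₁ ih₂ =>
    obtain ⟨m, hm⟩ := ih₁ (le_sup_left.trans h)
    obtain ⟨n, hn⟩ := ih₂ (le_sup_right.trans h)
    refine ⟨max m n, fun x hx q hq => ?_⟩
    obtain ⟨p, hp, p', hp', rfl⟩ := Submodule.mem_sup.1 hq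
    rw [smul_add, hm x (Ideal.pow_le_pow_right (le_max_left m n) hx) p hp,
      hn x (Ideal.pow_le_pow_right (le_max_right m n) hx) p' hp', add_zero]

/-- The submodule aq is finitely generated and torsion, so a single power a^n kills it. Consequently
Q modulo its torsion has no nonzero element killed by a. -/
theorem mem_powTorsion_of_forall_smul_mem [IsNoetherianRing R] {q : Q}
    (h : ∀ x ∈ a, x • q ∈ powTorsion a Q) : q ∈ powTorsion a Q := by
  obtain ⟨n, hn⟩ := exists_pow_smul_eq_zero_of_fg (a := a)
    (N := Submodule.map (LinearMap.toSpanSingleton R Q q) a)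
    ((IsNoetherian.noetherian a).map _) (by
      rintro _ ⟨x, hx, rfl⟩
      exact h x hx)
  refine ⟨n + 1, fun x hx => ?_⟩
  rw [pow_succ] at hx
  refine Submodule.mul_induction_on hx (fun y hy z hz => ?_) fun y z hy hz => ?_
  · rw [mul_smul]
    exact hn y hy _ ⟨z, hz, rfl⟩
  · rw [add_smul, hy, hz, add_zero]

theorem injective_of_retract {P : Type u} [AddCommGroup P] [Module R P]
    (hQ : Module.Injective R Q) (s : P →ₗ[R] Q) (r : Q →ₗ[R] P) (h : ∀ p, r (s p) = p) :
    Module.Injective R P where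
  out X Y _ _ _ _ f hf g := by
    obtain ⟨χ, hχ⟩ := hQ.out f hf (s ∘ₗ g)
    exact ⟨r ∘ₗ χ, fun x => by
      rw [LinearMap.comp_apply, hχ x, LinearMap.comp_apply, h]⟩

theorem injective_prod {P : Type u} [AddCommGroup P] [Module R P]
    (hP : Module.Injective R P) (hQ : Module.Injective R Q) : Module.Injective R (P × Q) where
  out X Y _ _ _ _ f hf g := by
    obtain ⟨χ, hχ⟩ := hP.out f hf (LinearMap.fst R P Q ∘ₗ g)
    obtain ⟨χ', hχ'⟩ := hQ.out f hf (LinearMap.snd R P Q ∘ₗ g)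
    exact ⟨χ.prod χ', fun x => Prod.ext (hχ x) (hχ' x)⟩

/-- Baer's criterion with Artin–Rees: the image of g : I → Q is killed by some a^n, and I ∩ a^(n+k)
⊆ a^n I, so g kills I ∩ a^(n+k). It extends through R/a^(n+k), and such an extension takes torsion
values. -/
theorem injective_powTorsion [IsNoetherianRing R] (hQ : Module.Injective R Q) :
    Module.Injective R (powTorsion a Q) := by
  refine Module.Baer.injective fun I g => ?_
  obtain ⟨n, hn⟩ := exists_pow_smul_eq_zero_of_fg (a := a)
    (N := LinearMap.range ((powTorsion a Q).subtype ∘ₗ g))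
    (Submodule.FG.of_finite) (by
      rintro _ ⟨x, rfl⟩
      exact (g x).2)
  obtain ⟨k, hk⟩ := Ideal.exists_pow_inf_eq_pow_smul a I
  have hle : a ^ (n + k) ⊓ I ≤ a ^ n • I := by
    have := hk (n + k) (Nat.le_add_left k n)
    rw [smul_eq_mul, Ideal.mul_top] at this
    rw [this, Nat.add_sub_cancel]
    exact Submodule.smul_mono le_rfl inf_le_right
  have hzero : ∀ x : I, (x : R) ∈ a ^ (n + k) → g x = 0 := by
    rintro ⟨x, hx⟩ hxa
    have hker : a ^ n • I ≤ (LinearMap.ker g).map I.subtype := Submodule.smul_le.2 fun r hr z hz =>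
      ⟨r • ⟨z, hz⟩, by
        rw [SetLike.mem_coe, LinearMap.mem_ker, map_smul]
        exact Subtype.ext (hn r hr _ ⟨⟨z, hz⟩, rfl⟩), rfl⟩
    obtain ⟨y, hy, hyx⟩ := hker (hle ⟨hxa, hx⟩)
    obtain rfl : y = ⟨x, hx⟩ := Subtype.ext hyx
    exact hy
  obtain ⟨χ, hχ⟩ := exists_comp_eq_of_exact hQ
    (LinearMap.ker ((Submodule.mkQ (a ^ (n + k) : Ideal R)) ∘ₗ I.subtype)).subtype
    ((Submodule.mkQ (a ^ (n + k) : Ideal R)) ∘ₗ I.subtype) (by rw [Submodule.range_subtype])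
    ((powTorsion a Q).subtype ∘ₗ g) (by
      ext ⟨x, hx⟩
      have hx' : (x : R) ∈ a ^ (n + k) := (Submodule.Quotient.mk_eq_zero _).1 hx
      simp [hzero x hx'])
  refine ⟨(χ ∘ₗ Submodule.mkQ _).codRestrict _ fun r => ⟨n + k, fun x hx => ?_⟩, fun x hx => ?_⟩
  · rw [← map_smul, smul_eq_mul, LinearMap.comp_apply, Submodule.mkQ_apply,
      (Submodule.Quotient.mk_eq_zero _).2 (Ideal.mul_mem_right r _ hx), map_zero]
  · exact Subtype.ext (LinearMap.congr_fun hχ ⟨x, hx⟩)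

/-- The torsion submodule is injective, hence a direct summand, and the quotient is a retract of Q.
-/
theorem injective_quotient_powTorsion [IsNoetherianRing R] (hQ : Module.Injective R Q) :
    Module.Injective R (Q ⧸ powTorsion a Q) := by
  obtain ⟨r, hr⟩ := (injective_powTorsion (a := a) hQ).out (powTorsion a Q).subtype
    (Submodule.injective_subtype _) LinearMap.id
  refine injective_of_retract hQ ((powTorsion a Q).liftQ
    (LinearMap.id - (powTorsion a Q).subtype ∘ₗ r) fun q hq => ?_) (powTorsion a Q).mkQ ?_
  · have := hr ⟨q, hq⟩
    simp only [Submodule.subtype_apply, LinearMap.id_apply] at this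
    simp [this]
  · intro p
    obtain ⟨q, rfl⟩ := Submodule.mkQ_surjective _ p
    rw [← sub_eq_zero, ← map_sub] 
    refine (Submodule.Quotient.mk_eq_zero _).2 ?_
    simp

end PowTorsion

/-! ### Embeddings into injective modules with finite socle -/

section FiniteSocle

open IsLocalRing

variable {R : Type u} [CommRing R] [IsLocalRing R] [IsNoetherianRing R]
  {E : Type u} [AddCommGroup E] [Module R E]

/-- The target E^μ × Q/Γ, with Γ the 𝔪-power torsion of Q, replaces an injective hull. The second
factor has no socle and detects non-torsion elements; on torsion elements ψ suffices, since it is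
injective on the socle. -/
theorem HasFiniteSocle.exists_injective_of_injective (hE : Module.Injective R E) {X Q : Type u}
    [AddCommGroup X] [Module R X] [AddCommGroup Q] [Module R Q] (hQ : Module.Injective R Q)
    (i : X →ₗ[R] Q) (hi : Function.Injective i) (hX : HasFiniteSocle (R := R) E X) :
    ∃ (J : ModuleCat.{u} R) (f : X →ₗ[R] J), Function.Injective f ∧
      Module.Injective R J ∧ HasFiniteSocle (R := R) E J := by
  obtain ⟨μ, ψ, hψ⟩ := hX
  let T := powTorsion (maximalIdeal R) Q
  have hJ : Module.Injective R ((Fin μ → E) × (Q ⧸ T)) :=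
    injective_prod inferInstance (injective_quotient_powTorsion hQ)
  refine ⟨ModuleCat.of R ((Fin μ → E) × (Q ⧸ T)), ψ.prod (T.mkQ ∘ₗ i), ?_, hJ, μ,
    LinearMap.fst R _ _, ?_⟩
  · refine (injective_iff_map_eq_zero _).2 fun x hx => ?_
    have h1 : ψ x = 0 := congrArg Prod.fst hx
    obtain ⟨n, hn⟩ := (Submodule.Quotient.mk_eq_zero T).1 (congrArg Prod.snd hx)
    by_contra hne
    obtain ⟨r, hr, hr'⟩ := exists_smul_mem_socle (n := n) (v := x)
      (fun y hy => hi (by rw [map_smul, map_zero]; exact hn y hy)) hne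
    exact hr (hψ _ hr' (by rw [map_smul, h1, smul_zero]))
  · rintro ⟨e, q⟩ hy he
    refine Prod.ext he ?_
    obtain ⟨q, rfl⟩ := Submodule.mkQ_surjective _ q
    refine (Submodule.Quotient.mk_eq_zero _).2 (mem_powTorsion_of_forall_smul_mem fun x hx => ?_)
    exact (Submodule.Quotient.mk_eq_zero T).1 (congrArg Prod.snd (hy x hx))

theorem HasFiniteSocle.exists_injective (hE : Module.Injective R E) (X : ModuleCat.{u} R)
    (hX : HasFiniteSocle (R := R) E X) : ∃ (J : ModuleCat.{u} R) (f : X ⟶ J),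
      Mono f ∧ Injective J ∧ HasFiniteSocle (R := R) E J := by
  obtain ⟨J, f, hf, hJ, hJ'⟩ := hX.exists_injective_of_injective hE
    (Module.injective_module_of_injective_object R (Injective.under X : ModuleCat.{u} R)
      (inj := Injective.injective_under X))
    (Injective.ι X).hom ((ModuleCat.mono_iff_injective _).1 inferInstance)
  exact ⟨J, ModuleCat.ofHom f, (ModuleCat.mono_iff_injective _).2 hf,
    Module.injective_object_of_injective_module R _, hJ'⟩

end FiniteSocle

/-! ### Finiteness of the Bass numbers -/

section Bass

open IsLocalRing

variable {R : Type u} [CommRing R] [IsLocalRing R] {E : Type u} [AddCommGroup E] [Module R E]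
  {ι : ResidueField R →ₗ[R] E} {X : Type u} [AddCommGroup X] [Module R X]

theorem exists_residueField_hom {x : X} (hx : ∀ r ∈ maximalIdeal R, r • x = 0) :
    ∃ φ : ResidueField R →ₗ[R] X, φ 1 = x := by
  let φ : (R ⧸ maximalIdeal R) →ₗ[R] X :=
    Submodule.liftQ _ (LinearMap.toSpanSingleton R X x) fun r hr => hx r hr
  exact ⟨φ, one_smul R x⟩

theorem residueField_hom_ext {φ ψ : ResidueField R →ₗ[R] X} (h : φ 1 = ψ 1) : φ = ψ := by
  ext c
  obtain ⟨r, rfl⟩ := residue_surjective c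
  have hr : residue R r = r • (1 : ResidueField R) := by
    rw [Algebra.smul_def, mul_one, ResidueField.algebraMap_eq]
  rw [hr, map_smul, map_smul, h]

theorem smul_residueField_hom_eq_zero (φ : ResidueField R →ₗ[R] X) {r : R}
    (hr : r ∈ maximalIdeal R) : r • φ 1 = 0 := by
  rw [← map_smul, smul_residueField_eq_zero hr, map_zero]

theorem isArtinian_of_fg_of_smul_eq_zero {N : Submodule R X} (hN : N.FG)
    (h : ∀ x ∈ N, ∀ r ∈ maximalIdeal R, r • x = 0) : IsArtinian R N := by
  induction N, hN using Submodule.fg_induction with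
  | singleton x =>
    obtain ⟨φ, rfl⟩ := exists_residueField_hom (h x (Submodule.mem_span_singleton_self x))
    have hle : Submodule.span R {φ 1} ≤ LinearMap.range φ :=
      (Submodule.span_singleton_le_iff_mem _ _).2 ⟨1, rfl⟩
    have := isArtinian_range φ
    exact isArtinian_of_injective (Submodule.inclusion hle) (Submodule.inclusion_injective hle)
  | sup N₁ N₂ _ _ ih₁ ih₂ =>
    have := ih₁ fun x hx => h x (Submodule.mem_sup_left hx)
    have := ih₂ fun x hx => h x (Submodule.mem_sup_right hx)
    infer_instance

/-- The socle is the image of Hom(k, X) under evaluation at 1. Being finitely generated and killed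
by 𝔪 it is artinian, so it embeds into a power of E, and the embedding extends to X. -/
theorem HasFiniteSocle.of_finite (hι : IsInjectiveHull ι)
    [Module.Finite R (ResidueField R →ₗ[R] X)] : HasFiniteSocle (R := R) E X := by
  let ev : (ResidueField R →ₗ[R] X) →ₗ[R] X := LinearMap.applyₗ 1
  have hart : IsArtinian R (LinearMap.range ev) :=
    isArtinian_of_fg_of_smul_eq_zero Submodule.FG.of_finite (by
      rintro _ ⟨φ, rfl⟩ r hr
      exact smul_residueField_hom_eq_zero φ hr)
  obtain ⟨n, t, ht⟩ := hι.exists_injective_pi (LinearMap.range ev)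
  have := hι.injective_module
  obtain ⟨ψ, hψ⟩ := Module.Injective.out (Q := Fin n → E) (LinearMap.range ev).subtype
    (Submodule.injective_subtype _) t
  refine ⟨n, ψ, fun y hy h0 => ?_⟩
  obtain ⟨φ, rfl⟩ := exists_residueField_hom hy
  have h1 := hψ ⟨φ 1, φ, rfl⟩
  rw [Submodule.subtype_apply, h0] at h1
  exact congrArg Subtype.val (ht (h1.symm.trans (map_zero t).symm))

theorem HasFiniteSocle.finite [IsNoetherianRing R] (hι : IsInjectiveHull ι)
    (h : HasFiniteSocle (R := R) E X) : Module.Finite R (ResidueField R →ₗ[R] X) := by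
  obtain ⟨μ, ψ, hψ⟩ := h
  have : Module.Finite R (ResidueField R) :=
    Module.Finite.of_surjective (Algebra.linearMap R (ResidueField R)) residue_surjective
  let ev : (ResidueField R →ₗ[R] X) →ₗ[R] (Fin μ → LinearMap.range ι) :=
    LinearMap.pi fun j => LinearMap.codRestrict _
      (LinearMap.proj j ∘ₗ ψ ∘ₗ LinearMap.applyₗ 1) fun φ =>
        hι.mem_range_of_forall_smul fun r hr => by
          rw [← map_smul]
          change ψ (r • φ 1) j = 0
          rw [smul_residueField_hom_eq_zero φ hr, map_zero]
          rfl
  refine Module.Finite.of_injective ev ((injective_iff_map_eq_zero _).2 fun φ hφ => ?_)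
  refine residueField_hom_ext (hψ _ (fun r => smul_residueField_hom_eq_zero φ) ?_)
  ext j
  exact congrArg Subtype.val (congrFun hφ j)

theorem HasFiniteSocle.of_isArtinian (hι : IsInjectiveHull ι) [IsArtinian R X] :
    HasFiniteSocle (R := R) E X := by
  obtain ⟨n, t, ht⟩ := hι.exists_injective_pi X
  exact ⟨n, t, fun y _ h0 => ht (h0.trans (map_zero t).symm)⟩

end Bass

theorem shortExact_quotient {R : Type u} [CommRing R] {X : ModuleCat.{u} R} (N : Submodule R X) :
    (ShortComplex.mk (ModuleCat.ofHom N.subtype) (ModuleCat.ofHom N.mkQ) (by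
      ext x
      exact (Submodule.Quotient.mk_eq_zero _).2 x.2)).ShortExact where
  exact := by
    rw [ShortComplex.moduleCat_exact_iff]
    intro x hx
    exact ⟨⟨x, (Submodule.Quotient.mk_eq_zero _).1 hx⟩, rfl⟩
  mono_f := (ModuleCat.mono_iff_injective _).2 (Submodule.injective_subtype _)
  epi_g := (ModuleCat.epi_iff_surjective _).2 (Submodule.mkQ_surjective _)

theorem finite_of_ker_le_range {R : Type u} [CommRing R] [IsNoetherianRing R]
    {A B C : Type*} [AddCommGroup A] [Module R A] [AddCommGroup B]
    [Module R B] [AddCommGroup C] [Module R C] [Module.Finite R A] [Module.Finite R C]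
    (f : A →ₗ[R] B) (g : B →ₗ[R] C) (h : LinearMap.ker g ≤ LinearMap.range f) :
    Module.Finite R B := by
  have h1 : (LinearMap.ker g).FG := by
    have : IsNoetherian R (LinearMap.range f) :=
      isNoetherian_of_surjective f.rangeRestrict f.range_rangeRestrict
    exact Submodule.FG.of_le Submodule.FG.of_finite h
  refine ⟨Submodule.fg_of_fg_map_of_fg_inf_ker g (IsNoetherian.noetherian _) ?_⟩
  rwa [top_inf_eq]

section ExtFinite

open IsLocalRing Abelian

variable {R : Type u} [CommRing R] [IsLocalRing R]

/-- All modules `Ext^i(k, X)`, for `k` the residue field, are finitely generated. -/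
def IsExtFinite (X : ModuleCat.{u} R) : Prop :=
  ∀ i, Module.Finite R (Ext (ModuleCat.of R (ResidueField R)) X i)

theorem IsExtFinite.hasFiniteSocle {E : Type u} [AddCommGroup E] [Module R E]
    {ι : ResidueField R →ₗ[R] E} (hι : IsInjectiveHull ι) {X : ModuleCat.{u} R}
    (h : IsExtFinite X) : HasFiniteSocle (R := R) E X := by
  have := h 0
  have : Module.Finite R (ResidueField R →ₗ[R] X) := Module.Finite.equiv
    ((Ext.linearEquiv₀ (R := R) (X := ModuleCat.of R (ResidueField R)) (Y := X)).trans
      (ModuleCat.homLinearEquiv (S := R)))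
  exact HasFiniteSocle.of_finite hι

variable [IsNoetherianRing R]

theorem IsExtFinite.middle {S : ShortComplex (ModuleCat.{u} R)} (hS : S.ShortExact)
    (h₁ : IsExtFinite S.X₁) (h₃ : IsExtFinite S.X₃) : IsExtFinite S.X₂ := fun i => by
  have := h₁ i
  have := h₃ i
  exact finite_of_ker_le_range
    ((Ext.mk₀ S.f).postcompOfLinear R (ModuleCat.of R (ResidueField R)) (add_zero i))
    ((Ext.mk₀ S.g).postcompOfLinear R (ModuleCat.of R (ResidueField R)) (add_zero i))
    fun x hx => Ext.covariant_sequence_exact₂ _ hS x hx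

theorem IsExtFinite.right {S : ShortComplex (ModuleCat.{u} R)} (hS : S.ShortExact)
    (h₁ : IsExtFinite S.X₁) (h₂ : IsExtFinite S.X₂) : IsExtFinite S.X₃ := fun i => by
  have := h₂ i
  have := h₁ (i + 1)
  exact finite_of_ker_le_range
    ((Ext.mk₀ S.g).postcompOfLinear R (ModuleCat.of R (ResidueField R)) (add_zero i))
    (hS.extClass.postcompOfLinear R (ModuleCat.of R (ResidueField R)) rfl)
    fun x hx => Ext.covariant_sequence_exact₃ _ hS x rfl hx

variable {E : Type u} [AddCommGroup E] [Module R E] {ι : ResidueField R →ₗ[R] E}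

theorem HasFiniteSocle.finite_ext_zero (hι : IsInjectiveHull ι) {X : ModuleCat.{u} R}
    (h : HasFiniteSocle (R := R) E X) :
    Module.Finite R (Ext (ModuleCat.of R (ResidueField R)) X 0) := by
  have : Module.Finite R (ModuleCat.of R (ResidueField R) →ₗ[R] X) := h.finite hι
  exact Module.Finite.equiv
    (Ext.linearEquiv₀.trans (ModuleCat.homLinearEquiv (S := R))).symm

theorem HasFiniteSocle.isExtFinite_of_injective (hι : IsInjectiveHull ι) {X : ModuleCat.{u} R}
    [Injective X] (h : HasFiniteSocle (R := R) E X) : IsExtFinite X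
  | 0 => h.finite_ext_zero hι
  | i + 1 => by
    have := Ext.subsingleton_of_injective (ModuleCat.of R (ResidueField R)) X i
    infer_instance

/-- Dimension shifting: X embeds into E^n with artinian cokernel, and Ext^(i+1)(k, X) is a quotient
of Ext^i(k, -) of this cokernel because E^n is injective. -/
theorem isExtFinite_of_isArtinian (hι : IsInjectiveHull ι) (X : ModuleCat.{u} R)
    [IsArtinian R X] : IsExtFinite X := fun i => by
  induction i generalizing X with
  | zero => exact (HasFiniteSocle.of_isArtinian hι).finite_ext_zero hι
  | succ i ih =>
    obtain ⟨n, t, ht⟩ := hι.exists_injective_pi X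
    have := hι.isArtinian
    have := hι.injective_module
    let S : ShortComplex (ModuleCat.{u} R) := ShortComplex.mk (ModuleCat.ofHom t)
      (ModuleCat.ofHom (LinearMap.range t).mkQ) (by
        ext x
        exact (Submodule.Quotient.mk_eq_zero _).2 ⟨x, rfl⟩)
    have hS : S.ShortExact :=
      { exact := by
          rw [ShortComplex.moduleCat_exact_iff]
          intro x hx
          exact (Submodule.Quotient.mk_eq_zero _).1 hx
        mono_f := (ModuleCat.mono_iff_injective _).2 ht
        epi_g := (ModuleCat.epi_iff_surjective _).2 (Submodule.mkQ_surjective _) }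
    have : Injective S.X₂ := Module.injective_object_of_injective_module R (Fin n → E)
    have hart : IsArtinian R ((Fin n → E) ⧸ LinearMap.range t) := inferInstance
    have := @ih S.X₃ hart
    exact Module.Finite.of_surjective
      (hS.extClass.postcompOfLinear R (ModuleCat.of R (ResidueField R)) rfl)
      fun x => Ext.covariant_sequence_exact₁ _ hS x (Ext.eq_zero_of_injective _) rfl

theorem IsMinimax.isExtFinite (hι : IsInjectiveHull ι) {X : ModuleCat.{u} R}
    (hX : IsMinimax R X) : IsExtFinite X := by
  obtain ⟨N, hN, hart⟩ := hX
  have : Module.Finite R (ResidueField R) :=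
    Module.Finite.of_surjective (Algebra.linearMap R (ResidueField R)) residue_surjective
  refine IsExtFinite.middle (shortExact_quotient N) (fun i => ?_) ?_
  · change Module.Finite R (Ext _ (ModuleCat.of R N) i)
    infer_instance
  · change IsExtFinite (ModuleCat.of R (X ⧸ N))
    have : IsArtinian R (ModuleCat.of R (X ⧸ N)) := hart
    exact isExtFinite_of_isArtinian hι _

/-- A module with finite Bass numbers embeds into an injective module with finite socle, with
cokernel again of finite Bass numbers. -/
theorem IsExtFinite.exists_injective (hι : IsInjectiveHull ι) {X : ModuleCat.{u} R}
    (hX : IsExtFinite X) : ∃ (J : ModuleCat.{u} R) (f : X ⟶ J), Mono f ∧ Injective J ∧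
      HasFiniteSocle (R := R) E J ∧ IsExtFinite (Limits.cokernel f) := by
  obtain ⟨J, f, hf, hJ, hJ'⟩ := (hX.hasFiniteSocle hι).exists_injective hι.injective_module
  refine ⟨J, f, hf, hJ, hJ', ?_⟩
  exact IsExtFinite.right (S := ShortComplex.mk f (Limits.cokernel.π f) (by simp))
    { exact := ShortComplex.exact_cokernel f } hX (hJ'.isExtFinite_of_injective hι)

end ExtFinite

/-! ### Injective resolutions with prescribed terms -/

section Resolution

open Limits

universe v w

variable {C : Type w} [Category.{v} C] [Abelian C]

theorem exact_comp_mono {X Y Z W : C} {f : X ⟶ Y} {p : Y ⟶ Z} (g : Z ⟶ W) [Mono g]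
    {h : f ≫ p = 0} (hfp : (ShortComplex.mk f p h).Exact) :
    (ShortComplex.mk f (p ≫ g) (by rw [reassoc_of% h, zero_comp])).Exact := by
  let φ : ShortComplex.mk f p h ⟶ ShortComplex.mk f (p ≫ g) (by rw [reassoc_of% h, zero_comp]) :=
    { τ₁ := 𝟙 _, τ₂ := 𝟙 _, τ₃ := g }
  have : Epi φ.τ₁ := inferInstanceAs (Epi (𝟙 X))
  have : IsIso φ.τ₂ := inferInstanceAs (IsIso (𝟙 Y))
  have : Mono φ.τ₃ := inferInstanceAs (Mono g)
  exact (ShortComplex.exact_iff_of_epi_of_isIso_of_mono φ).1 hfp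

theorem exact_epi_comp {X Y Z W : C} {f : X ⟶ Y} {p : Y ⟶ Z} (g : W ⟶ X) [Epi g]
    {h : f ≫ p = 0} (hfp : (ShortComplex.mk f p h).Exact) :
    (ShortComplex.mk (g ≫ f) p (by rw [Category.assoc, h, comp_zero])).Exact := by
  let φ : ShortComplex.mk (g ≫ f) p (by rw [Category.assoc, h, comp_zero]) ⟶
    ShortComplex.mk f p h := { τ₁ := g, τ₂ := 𝟙 _, τ₃ := 𝟙 _ }
  have : Epi φ.τ₁ := inferInstanceAs (Epi g)
  have : IsIso φ.τ₂ := inferInstanceAs (IsIso (𝟙 Y))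
  have : Mono φ.τ₃ := inferInstanceAs (Mono (𝟙 Z))
  exact (ShortComplex.exact_iff_of_epi_of_isIso_of_mono φ).2 hfp

section Splice

variable (K J : ℕ → C) (j : ∀ n, K n ⟶ J n) (p : ∀ n, J n ⟶ K (n + 1))

theorem splice_comp_splice (h : ∀ n, j n ≫ p n = 0) (n : ℕ) :
    (p n ≫ j (n + 1)) ≫ p (n + 1) ≫ j (n + 1 + 1) = 0 := by
  rw [Category.assoc, ← Category.assoc (j (n + 1)), h, zero_comp, comp_zero]

variable (h : ∀ n, j n ≫ p n = 0)

/-- The complex obtained by splicing the complexes `0 → K n → J n → K (n + 1) → 0`. -/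
abbrev spliceComplex : CochainComplex C ℕ where
  X := J
  d := CochainComplex.of.d J fun n => p n ≫ j (n + 1)
  shape := (CochainComplex.of J _ (splice_comp_splice K J j p h)).shape
  d_comp_d' := (CochainComplex.of J _ (splice_comp_splice K J j p h)).d_comp_d'

theorem spliceComplex_d (n : ℕ) :
    (spliceComplex K J j p h).d n (n + 1) = p n ≫ j (n + 1) :=
  CochainComplex.of_d J (fun n => p n ≫ j (n + 1)) n

theorem exact_splice₀ (hS : ∀ n, (ShortComplex.mk (j n) (p n) (h n)).ShortExact)
    (w : j 0 ≫ (spliceComplex K J j p h).d 0 1 = 0) :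
    (ShortComplex.mk (j 0) ((spliceComplex K J j p h).d 0 1) w).Exact := by
  have := (hS 1).mono_f
  have key := exact_comp_mono (j 1) (hS 0).exact
  convert key using 2
  exact spliceComplex_d K J j p h 0

theorem exact_splice (hS : ∀ n, (ShortComplex.mk (j n) (p n) (h n)).ShortExact) (n : ℕ) :
    (ShortComplex.mk _ _ ((spliceComplex K J j p h).d_comp_d n (n + 1) (n + 2))).Exact := by
  have := (hS (n + 2)).mono_f
  have := (hS n).epi_g
  have key := exact_epi_comp (p n) (exact_comp_mono (j (n + 2)) (hS (n + 1)).exact)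
  convert key using 2
  · exact spliceComplex_d K J j p h n
  · exact spliceComplex_d K J j p h (n + 1)

theorem exists_injectiveResolution_splice (hS : ∀ n, (ShortComplex.mk (j n) (p n) (h n)).ShortExact)
    (hJ : ∀ n, Injective (J n)) :
    ∃ I : InjectiveResolution (K 0), ∀ n, I.cocomplex.X n = J n := by
  have hj := (hS 0).mono_f
  have h0 : j 0 ≫ (spliceComplex K J j p h).d 0 1 = 0 := by
    rw [spliceComplex_d K J j p h 0, ← Category.assoc, h, zero_comp]
  refine ⟨{ cocomplex := spliceComplex K J j p h
            injective := hJ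
            ι := (CochainComplex.fromSingle₀Equiv _ _).symm ⟨j 0, h0⟩
            quasiIso := ⟨fun n => ?_⟩ }, fun n => rfl⟩
  cases n with
  | zero =>
    rw [CochainComplex.quasiIsoAt₀_iff, ShortComplex.quasiIso_iff_of_zeros]
    · refine (ShortComplex.exact_and_mono_f_iff_of_iso ?_).2 ⟨exact_splice₀ K J j p h hS h0, hj⟩
      have hf := CochainComplex.fromSingle₀Equiv_symm_apply_f_zero
        (C := spliceComplex K J j p h) (X := K 0) (j 0) h0
      exact ShortComplex.isoMk (Iso.refl _) (Iso.refl _) (Iso.refl _)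
        ((Category.id_comp _).trans (hf.symm.trans (Category.comp_id _).symm))
        ((Category.id_comp _).trans (Category.comp_id _).symm)
    · rfl
    · rfl
    · rfl
  | succ n =>
    rw [quasiIsoAt_iff_exactAt]
    · rw [HomologicalComplex.exactAt_iff' _ n (n + 1) (n + 1 + 1) (by simp) (by simp)]
      exact exact_splice K J j p h hS n
    · exact CochainComplex.exactAt_succ_single_obj _ _

end Splice

/-- The property P passes to cokernels, so the embeddings can be iterated and the resulting short
exact sequences spliced. -/
theorem exists_injectiveResolution {P Q : C → Prop}
    (h : ∀ X, P X → ∃ (J : C) (f : X ⟶ J), Mono f ∧ Injective J ∧ Q J ∧ P (cokernel f))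
    (X : C) (hX : P X) : ∃ J : InjectiveResolution X, ∀ n, Q (J.cocomplex.X n) := by
  choose J f hf hJ hQ hP using h
  let K : ℕ → {X : C // P X} :=
    fun n => Nat.rec ⟨X, hX⟩ (fun _ Y => ⟨cokernel (f Y.1 Y.2), hP Y.1 Y.2⟩) n
  obtain ⟨I, hI⟩ := exists_injectiveResolution_splice (fun n => (K n).1)
    (fun n => J (K n).1 (K n).2) (fun n => f (K n).1 (K n).2)
    (fun n => cokernel.π (f (K n).1 (K n).2)) (fun n => cokernel.condition _)
    (fun n => { exact := ShortComplex.exact_cokernel _, mono_f := hf _ _ }) (fun n => hJ _ _)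
  exact ⟨I, fun n => by rw [hI]; exact hQ _ _⟩

end Resolution

/-! ### Independence of the resolution -/

section Homotopy

variable {R : Type u} [CommRing R] (E : Type u) [AddCommGroup E] [Module R E]
  (L : ModuleCat.{u} R) {C C' : CochainComplex (ModuleCat.{u} R) ℕ}

/-- The chain map `Hom(C', E) → Hom(C, E)` induced by `f : C → C'`. -/
def dualMap (f : C ⟶ C') : dualComplex E C' ⟶ dualComplex E C where
  f n := ModuleCat.ofHom (LinearMap.lcomp R E (f.f n).hom)
  comm' i j _ := by
    refine ModuleCat.hom_ext (LinearMap.ext fun (ψ : C'.X i →ₗ[R] E) => LinearMap.ext fun x => ?_)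
    exact congrArg ψ
      (LinearMap.congr_fun (congrArg ModuleCat.Hom.hom (f.comm j i)) x).symm

/-- The cochain map `Hom(L, C) → Hom(L, C')` induced by `f : C → C'`. -/
def homMap (f : C ⟶ C') : homComplex L C ⟶ homComplex L C' where
  f n := ModuleCat.ofHom (LinearMap.compRight R (M := L) (f.f n).hom)
  comm' i j _ := by
    refine ModuleCat.hom_ext (LinearMap.ext fun (φ : L →ₗ[R] C.X i) => LinearMap.ext fun x => ?_)
    exact LinearMap.congr_fun (congrArg ModuleCat.Hom.hom (f.comm i j)) (φ x)

/-- A homotopy between `f` and `g` induces one between the maps of dual complexes. -/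
def dualHomotopy {f g : C ⟶ C'} (h : Homotopy f g) : Homotopy (dualMap E f) (dualMap E g) where
  hom i j := ModuleCat.ofHom (LinearMap.lcomp R E (h.hom j i).hom)
  zero i j hij := by
    rw [h.zero j i hij]
    ext ψ x
    exact map_zero (ψ : C'.X i →ₗ[R] E)
  comm i := by
    refine ModuleCat.hom_ext (LinearMap.ext fun (ψ : C'.X i →ₗ[R] E) => LinearMap.ext fun x => ?_)
    have hx := LinearMap.congr_fun (congrArg ModuleCat.Hom.hom (h.comm i)) x
    have := congrArg ψ hx
    refine this.trans ((map_add ψ _ _).trans ?_)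
    -- Dualizing reverses the differentials, so the two homotopy terms trade places.
    refine congrArg (· + _) ((map_add ψ _ _).trans (add_comm _ _))

/-- A homotopy between `f` and `g` induces one between `Hom(L, f)` and `Hom(L, g)`. -/
def homHomotopy {f g : C ⟶ C'} (h : Homotopy f g) : Homotopy (homMap L f) (homMap L g) where
  hom i j := ModuleCat.ofHom (LinearMap.compRight R (M := L) (h.hom i j).hom)
  zero i j hij := by
    rw [h.zero i j hij]
    ext φ x
    rfl
  comm i := by
    refine ModuleCat.hom_ext (LinearMap.ext fun (φ : L →ₗ[R] C.X i) => LinearMap.ext fun x => ?_)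
    exact LinearMap.congr_fun (congrArg ModuleCat.Hom.hom (h.comm i)) (φ x)

/-- The dual of a homotopy equivalence. -/
def dualHomotopyEquiv (e : HomotopyEquiv C C') :
    HomotopyEquiv (dualComplex E C') (dualComplex E C) where
  hom := dualMap E e.hom
  inv := dualMap E e.inv
  homotopyHomInvId := dualHomotopy E e.homotopyInvHomId
  homotopyInvHomId := dualHomotopy E e.homotopyHomInvId

/-- The homotopy equivalence `Hom(L, C) → Hom(L, C')` induced by a homotopy equivalence. -/
def homHomotopyEquiv (e : HomotopyEquiv C C') :
    HomotopyEquiv (homComplex L C) (homComplex L C') where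
  hom := homMap L e.hom
  inv := homMap L e.inv
  homotopyHomInvId := homHomotopy L e.homotopyHomInvId
  homotopyInvHomId := homHomotopy L e.homotopyInvHomId

theorem homEvalComplex_naturality (f : C ⟶ C') :
    (((MonoidalCategory.tensoringLeft (ModuleCat.{u} R)).obj L).mapHomologicalComplex _).map
      (dualMap E f) ≫ homEvalComplex E L C =
    homEvalComplex E L C' ≫ dualMap E (homMap L f) := by
  ext n : 1
  apply ModuleCat.hom_ext
  apply TensorProduct.ext'
  intro l ψ
  rfl

/-- In the naturality square the maps induced by e are homotopy equivalences. This transfers the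
result from a resolution with finite socles to any other. -/
theorem isIso_homologyMap_homEvalComplex_of_homotopyEquiv (e : HomotopyEquiv C C') (i : ℕ)
    (h : IsIso (HomologicalComplex.homologyMap (homEvalComplex E L C') i)) :
    IsIso (HomologicalComplex.homologyMap (homEvalComplex E L C) i) := by
  have h1 : IsIso (HomologicalComplex.homologyMap
      ((((MonoidalCategory.tensoringLeft (ModuleCat.{u} R)).obj L).mapHomologicalComplex _).map
        (dualMap E e.hom)) i) :=
    Iso.isIso_hom ((((MonoidalCategory.tensoringLeft (ModuleCat.{u} R)).obj L).mapHomotopyEquiv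
      (dualHomotopyEquiv E e)).toHomologyIso i)
  have h2 : IsIso (HomologicalComplex.homologyMap (dualMap E (homMap L e.hom)) i) :=
    Iso.isIso_hom ((dualHomotopyEquiv E (homHomotopyEquiv L e)).toHomologyIso i)
  have key := congrArg (fun f => HomologicalComplex.homologyMap f i)
    (homEvalComplex_naturality E L e.hom)
  simp only [HomologicalComplex.homologyMap_comp] at key
  have h3 : IsIso (HomologicalComplex.homologyMap
      ((((MonoidalCategory.tensoringLeft (ModuleCat.{u} R)).obj L).mapHomologicalComplex _).map
        (dualMap E e.hom)) i ≫ HomologicalComplex.homologyMap (homEvalComplex E L C) i) := by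
    rw [key]
    infer_instance
  exact @IsIso.of_isIso_comp_left _ _ _ _ _ _ _ h1 h3

end Homotopy

/-! ### The main theorem -/

section Annihilator

open Abelian

variable {R : Type u} [CommRing R] {L L' : ModuleCat.{u} R}

theorem smul_id_eq_zero {x : R} (hx : x ∈ Module.annihilator R L) : x • 𝟙 L = 0 := by
  ext l
  exact Module.mem_annihilator.1 hx l

theorem smul_ext_eq_zero {x : R} (hx : x ∈ Module.annihilator R L ⊔ Module.annihilator R L')
    {i : ℕ} (α : Ext L L' i) : x • α = 0 := by
  obtain ⟨y, hy, z, hz, rfl⟩ := Submodule.mem_sup.1 hx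
  have h1 : y • α = 0 := by
    rw [← Ext.mk₀_id_comp α, ← Ext.smul_comp, ← Ext.mk₀_smul, smul_id_eq_zero hy, Ext.mk₀_zero,
      Ext.zero_comp]
  have h2 : z • α = 0 := by
    rw [Ext.smul_eq_comp_mk₀, smul_id_eq_zero hz, Ext.mk₀_zero, Ext.comp_zero]
  rw [add_smul, h1, h2, add_zero]

/-- The class of x φ in Ext(L, L') is zero because x kills Ext, acting through either argument; a
cocycle with zero class is a coboundary. -/
theorem exists_comp_eq_smul (J : InjectiveResolution L') {x : R}
    (hx : x ∈ Module.annihilator R L ⊔ Module.annihilator R L') {i : ℕ}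
    (φ : L →ₗ[R] J.cocomplex.X i) (hφ : (J.cocomplex.d i (i + 1)).hom ∘ₗ φ = 0) :
    ∃ (j : ℕ) (φ' : L →ₗ[R] J.cocomplex.X j), (J.cocomplex.d j i).hom ∘ₗ φ' = x • φ := by
  have hk : (ComplexShape.up ℕ).next i = i + 1 := ComplexShape.next_eq' _ rfl
  have hφ' : ((homComplex L J.cocomplex).sc i).g.hom φ = 0 := by
    change (J.cocomplex.d i ((ComplexShape.up ℕ).next i)).hom ∘ₗ φ = 0
    rwa [hk]
  have h0 : x • (⟨φ, hφ'⟩ : LinearMap.ker ((homComplex L J.cocomplex).sc i).g.hom) ∈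
      LinearMap.ker (cocycleToExt L J i) := by
    rw [LinearMap.mem_ker, map_smul, smul_ext_eq_zero hx]
  rw [ker_cocycleToExt] at h0
  obtain ⟨y, hy⟩ := h0
  -- The index is `prev i`; for i = 0 the incoming differential is zero, so x φ itself vanishes.
  exact ⟨_, y, congrArg Subtype.val hy⟩

end Annihilator

section Main

open IsLocalRing

variable {R : Type u} [CommRing R] [IsLocalRing R] [IsNoetherianRing R]
  {E : Type u} [AddCommGroup E] [Module R E] {ι : ResidueField R →ₗ[R] E}

theorem isSurjectiveModulo_annihilator_sup (hι : IsInjectiveHull ι) {M M' : ModuleCat.{u} R}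
    (hM : IsMinimax R M) (hM' : IsMinimax R M')
    (h : IsAdicComplete (maximalIdeal R) (R ⧸ (Module.annihilator R M ⊔ Module.annihilator R M')) ∨
      IsMatlisReflexive R E M ∨ IsMatlisReflexive R E M') :
    IsSurjectiveModulo (maximalIdeal R) (Module.annihilator R M ⊔ Module.annihilator R M') := by
  rcases h with h | h | h
  · exact IsSurjectiveModulo.of_isAdicComplete h
  · exact (h.isSurjectiveModulo hι hM).mono le_sup_left
  · exact (h.isSurjectiveModulo hι hM').mono le_sup_right

theorem IsMinimax.exists_injectiveResolution (hι : IsInjectiveHull ι) {M : ModuleCat.{u} R}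
    (hM : IsMinimax R M) :
    ∃ J : InjectiveResolution M, ∀ n, HasFiniteSocle (R := R) E (J.cocomplex.X n) :=
  Matlis.exists_injectiveResolution (P := IsExtFinite)
    (Q := fun X : ModuleCat.{u} R => HasFiniteSocle (R := R) E X)
    (fun _ hX => hX.exists_injective hι) M (hM.isExtFinite hι)

theorem IsMinimax.isIso_homologyMap_homEvalComplex (hι : IsInjectiveHull ι)
    {M M' : ModuleCat.{u} R} (hM : IsMinimax R M) (hM' : IsMinimax R M')
    (h : IsSurjectiveModulo (maximalIdeal R) (Module.annihilator R M ⊔ Module.annihilator R M'))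
    (J : InjectiveResolution M') (i : ℕ) :
    IsIso (HomologicalComplex.homologyMap (homEvalComplex E M J.cocomplex) i) := by
  obtain ⟨J', hJ'⟩ := hM'.exists_injectiveResolution hι
  refine isIso_homologyMap_homEvalComplex_of_homotopyEquiv E M
    (InjectiveResolution.homotopyEquiv J J') i ?_
  refine Matlis.isIso_homologyMap_homEvalComplex hι.injective_module M J'.cocomplex
    (injectiveResolution_injective J') (fun n => ?_) i
  obtain ⟨N, hN, hA⟩ := hM
  refine IsEvalExactAt.of_quotient hι.injective_module N J'.cocomplex n ?_
  refine IsEvalExactAt.of_isArtinian hι J'.cocomplex hJ' h n fun x hx φ hφ => ?_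
  refine exists_comp_eq_smul (L := ModuleCat.of R (M ⧸ N)) J' ?_ φ hφ
  -- Passing to M/N only enlarges the annihilator, so the ideal attached to M and M' still kills
  -- Ext(M/N, M').
  have hle : Module.annihilator R M ≤ Module.annihilator R (M ⧸ N) :=
    LinearMap.annihilator_le_of_surjective N.mkQ N.mkQ_surjective
  exact sup_le_sup_right hle (Module.annihilator R M') hx

theorem IsMinimax.theta_bijective (hι : IsInjectiveHull ι)
    {M M' : ModuleCat.{u} R} (hM : IsMinimax R M) (hM' : IsMinimax R M')
    (h : IsSurjectiveModulo (maximalIdeal R) (Module.annihilator R M ⊔ Module.annihilator R M'))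
    (J : InjectiveResolution M') (i : ℕ) :
    Function.Bijective (Theta hι.injective_module M J i) := by
  have h1 := (ConcreteCategory.isIso_iff_bijective _).1
    (hM.isIso_homologyMap_homEvalComplex hι hM' h J i)
  have h2 := (ConcreteCategory.isIso_iff_bijective _).1
    (isIso_torToHomology hι.injective_module M J i)
  have h3 := dualHomology_bijective hι.injective_module (homComplex M J.cocomplex) i
  have h4 : Function.Bijective
      (LinearMap.lcomp R E (cohomologyEquivExt M J i).symm.toLinearMap) :=
    ((cohomologyEquivExt M J i).symm.congrLeft E R).symm.bijective
  exact h4.comp (h3.comp (h1.comp h2))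

end Main

end

end Matlis

theorem mainTheorem5 {R : Type u} [CommRing R] [IsLocalRing R] [IsNoetherianRing R]
    {E : Type u} [AddCommGroup E] [Module R E] (ι : IsLocalRing.ResidueField R →ₗ[R] E)
    (hι : Matlis.IsInjectiveHull ι)
    (M M' : ModuleCat.{u} R) (hM : Matlis.IsMinimax R M) (hM' : Matlis.IsMinimax R M')
    (h : IsAdicComplete (IsLocalRing.maximalIdeal R)
          (R ⧸ (Module.annihilator R M ⊔ Module.annihilator R M')) ∨
        Matlis.IsMatlisReflexive R E M ∨ Matlis.IsMatlisReflexive R E M')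
    (J : CategoryTheory.InjectiveResolution M') (i : ℕ) :
    Function.Bijective (Matlis.Theta hι.injective_module M J i) ∧
      Nonempty (Unique (Matlis.CompletionStructure R E)) ∧
      Nonempty (Unique (Matlis.CompletionStructure R (CategoryTheory.Abelian.Ext M M' i))) ∧
      ∀ (S : Matlis.CompletionStructure R (CategoryTheory.Abelian.Ext M M' i))
        (S' : Matlis.CompletionStructure R E),
        Function.Bijective (Matlis.completionHomInclusion R S S') := by
  have hI := Matlis.isSurjectiveModulo_annihilator_sup hι hM hM' h
  have hl : ∀ x ∈ Module.annihilator R M ⊔ Module.annihilator R M',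
      ∀ l : CategoryTheory.Abelian.Ext M M' i, x • l = 0 := fun x hx l =>
    Matlis.smul_ext_eq_zero hx l
  exact ⟨hM.theta_bijective hι hM' hI J i,
    Matlis.nonempty_unique_of_isPowTorsion hι.isPowTorsion,
    Matlis.nonempty_unique_of_isSurjectiveModulo hI hl,
    Matlis.completionHomInclusion_bijective hI hl⟩
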